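/- A turnpike of speed $v>1$ is given by its endpoints $t,t'\in\mathbb R^2$ and can be entered and left only at these. Its length is the Euclidean distance $\|t-t'\|_2$. Off the turnpike one travels at unit speed in the $L_1$ metric, so that the travel time from a point $p$ to a facility $f\in\mathbb R^2$ is $$d(p)=\min\Big\{\|p-f\|_1,\ \|p-t\|_1+\tfrac{\|t-t'\|_2}{v}+\|t'-f\|_1,\ \|p-t'\|_1+\tfrac{\|t-t'\|_2}{v}+\|t-f\|_1\Big\}.$$ Given $n\ge 1$ points $p_1,\dots,p_n\in\mathbb R^2$ (in arbitrary position) and a speed $v>1$, consider the problem of computing $f,t,t'$ that minimize $\max_{1\le i\le n} d(p_i)$. In the fixed-length problem a number $\ell\ge 0$ is also given, and $f,t,t'$ range over all triples of points with $\|t-t'\|_2=\ell$. In the variable-length problem $f,t,t'$ range over all triples of points. **Theorem.** Each of the two problems can be solved, exactly and on all its instances, by a real RAM program that runs in $O(n^2)$ time and uses $O(n)$ space; the implied constants depend neither on the points nor on $v$ and $\ell$. Here a real RAM program is a fixed, finite, deterministic program that works on exact real numbers with the operations $+,-,\times,/,\sqrt{\ }$ and comparison, with rational constants, and on finitely many index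 registers holding natural numbers, which can be copied, set to constants, incremented, decremented, compared and used to address arrays of real numbers. The numbers $v$, $\ell$ (if any), $n$ and the coordinates of the points are its input. Every operation, memory access and control step takes one unit of time. Space is the number of memory cells in use, including the input. -/

import Mathlib

open Filter Asymptotics

noncomputable section

/-! ## A real RAM

Programs run on finitely many index registers (natural numbers), finitely many real registers and
finitely many arrays of real numbers. Every arithmetic operation, comparison, memory access and
control step has unit cost. Real registers hold exact reals, with the operations `+`, `-`, `*`, `/`
and square root and with rational constants in the program text. Index registers can only be
copied, set to a constant, incremented, decremented and compared. So after `k` steps every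
index is at most the input size plus a program constant times `k + 1`: no integer ever has more than
logarithmically many bits in the running time, and there is no rounding from reals to integers. -/

namespace RealRAM

/-- The contents of the memory of the machine. -/
structure State where
  /-- index registers -/
  idx : ℕ → ℕ
  /-- real registers -/
  reg : ℕ → ℝ
  /-- `arr a k` is the cell number `k` of the array with name `a` -/
  arr : ℕ → ℕ → ℝ

/-- Expressions for indices. -/
inductive IExpr where
  | const (k : ℕ)
  | var (i : ℕ)
  | succ (e : IExpr)
  | pred (e : IExpr)

/-- The value of an index expression (the predecessor of `0` is `0`). -/
def IExpr.eval (σ : State) : IExpr → ℕ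
  | .const k => k
  | .var i => σ.idx i
  | .succ e => e.eval σ + 1
  | .pred e => e.eval σ - 1

/-- The cost of an index expression: its number of nodes. -/
def IExpr.cost : IExpr → ℕ
  | .const _ => 1
  | .var _ => 1
  | .succ e => e.cost + 1
  | .pred e => e.cost + 1

/-- Expressions over the real registers. -/
inductive RExpr where
  | const (q : ℚ)
  | reg (r : ℕ)
  | add (a b : RExpr)
  | sub (a b : RExpr)
  | mul (a b : RExpr)
  | div (a b : RExpr)
  | sqrt (a : RExpr)

/-- The value of a real expression. Division by zero and the square root of a negative number
return `0`; this adds no power, as a comparison with `0` has unit cost. -/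
def RExpr.eval (σ : State) : RExpr → ℝ
  | .const q => (q : ℝ)
  | .reg r => σ.reg r
  | .add a b => a.eval σ + b.eval σ
  | .sub a b => a.eval σ - b.eval σ
  | .mul a b => a.eval σ * b.eval σ
  | .div a b => a.eval σ / b.eval σ
  | .sqrt a => Real.sqrt (a.eval σ)

/-- The cost of a real expression: its number of nodes. -/
def RExpr.cost : RExpr → ℕ
  | .const _ => 1
  | .reg _ => 1
  | .add a b => a.cost + b.cost + 1
  | .sub a b => a.cost + b.cost + 1
  | .mul a b => a.cost + b.cost + 1
  | .div a b => a.cost + b.cost + 1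
  | .sqrt a => a.cost + 1

/-- Conditions that a program can test. -/
inductive Cond where
  | realLe (a b : RExpr)
  | realLt (a b : RExpr)
  | idxLe (a b : IExpr)
  | idxLt (a b : IExpr)
  | neg (c : Cond)
  | both (c d : Cond)

/-- Truth of a condition. -/
def Cond.Holds (σ : State) : Cond → Prop
  | .realLe a b => a.eval σ ≤ b.eval σ
  | .realLt a b => a.eval σ < b.eval σ
  | .idxLe a b => a.eval σ ≤ b.eval σ
  | .idxLt a b => a.eval σ < b.eval σ
  | .neg c => ¬ c.Holds σ
  | .both c d => c.Holds σ ∧ d.Holds σ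

/-- The cost of a condition: its number of nodes. -/
def Cond.cost : Cond → ℕ
  | .realLe a b => a.cost + b.cost + 1
  | .realLt a b => a.cost + b.cost + 1
  | .idxLe a b => a.cost + b.cost + 1
  | .idxLt a b => a.cost + b.cost + 1
  | .neg c => c.cost + 1
  | .both c d => c.cost + d.cost + 1

/-- Programs. -/
inductive Prog where
  | skip
  /-- index register `i` receives the value of `e` -/
  | setIdx (i : ℕ) (e : IExpr)
  /-- real register `r` receives the value of `e` -/
  | setReg (r : ℕ) (e : RExpr)
  /-- real register `r` receives cell `e` of array `a` -/
  | load (r a : ℕ) (e : IExpr)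
  /-- cell `e` of array `a` receives the value of `x` -/
  | store (a : ℕ) (e : IExpr) (x : RExpr)
  | seq (p q : Prog)
  | branch (c : Cond) (p q : Prog)
  | loop (c : Cond) (p : Prog)

/-- `Exec m p σ k τ`: on a machine whose arrays have `m` cells each (numbered from `0` to `m - 1`),
the program `p` started in the state `σ` terminates in the state `τ` after exactly `k` steps.
An access beyond the end of an array is a fault: such a run has no derivation. A program names only
finitely many registers and arrays, so the memory in use during the run is at most a constant
multiple (the number of names in the program) of `m + 1`. -/
inductive Exec (m : ℕ) : Prog → State → ℕ → State → Prop where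
  | skip (σ : State) : Exec m .skip σ 1 σ
  | setIdx (σ : State) (i : ℕ) (e : IExpr) :
      Exec m (.setIdx i e) σ (e.cost + 1)
        { σ with idx := Function.update σ.idx i (e.eval σ) }
  | setReg (σ : State) (r : ℕ) (e : RExpr) :
      Exec m (.setReg r e) σ (e.cost + 1)
        { σ with reg := Function.update σ.reg r (e.eval σ) }
  | load (σ : State) (r a : ℕ) (e : IExpr) (h : e.eval σ < m) :
      Exec m (.load r a e) σ (e.cost + 1)
        { σ with reg := Function.update σ.reg r (σ.arr a (e.eval σ)) }
  | store (σ : State) (a : ℕ) (e : IExpr) (x : RExpr) (h : e.eval σ < m) :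
      Exec m (.store a e x) σ (e.cost + x.cost + 1)
        { σ with
          arr := Function.update σ.arr a (Function.update (σ.arr a) (e.eval σ) (x.eval σ)) }
  | seq {p q : Prog} {σ τ ρ : State} {k l : ℕ} (hp : Exec m p σ k τ) (hq : Exec m q τ l ρ) :
      Exec m (.seq p q) σ (k + l) ρ
  | branchTrue {c : Cond} {p q : Prog} {σ τ : State} {k : ℕ} (hc : c.Holds σ)
      (hp : Exec m p σ k τ) : Exec m (.branch c p q) σ (c.cost + 1 + k) τ
  | branchFalse {c : Cond} {p q : Prog} {σ τ : State} {k : ℕ} (hc : ¬ c.Holds σ)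
      (hq : Exec m q σ k τ) : Exec m (.branch c p q) σ (c.cost + 1 + k) τ
  | loopTrue {c : Cond} {p : Prog} {σ τ ρ : State} {k l : ℕ} (hc : c.Holds σ)
      (hp : Exec m p σ k τ) (hl : Exec m (.loop c p) τ l ρ) :
      Exec m (.loop c p) σ (c.cost + 1 + k + l) ρ
  | loopFalse {c : Cond} {p : Prog} {σ : State} (hc : ¬ c.Holds σ) :
      Exec m (.loop c p) σ (c.cost + 1) σ

end RealRAM

/-! ## The 1-center 1-turnpike problem -/

namespace Turnpike

/-- The `L₁` distance in the plane. -/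
def l1Dist (p q : ℝ × ℝ) : ℝ := |p.1 - q.1| + |p.2 - q.2|

/-- The Euclidean distance in the plane. -/
def l2Dist (p q : ℝ × ℝ) : ℝ := Real.sqrt ((p.1 - q.1) ^ 2 + (p.2 - q.2) ^ 2)

/-- A facility `f` together with a turnpike with endpoints `t` and `t'`. -/
structure Placement where
  f : ℝ × ℝ
  t : ℝ × ℝ
  t' : ℝ × ℝ

/-- The (Euclidean) length of the turnpike. -/
def Placement.length (P : Placement) : ℝ := l2Dist P.t P.t'

/-- The travel time from `p` to the facility when the turnpike has speed `v`: the client walks, or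
uses the whole turnpike in one of its two directions. -/
def Placement.travelTime (P : Placement) (v : ℝ) (p : ℝ × ℝ) : ℝ :=
  min (l1Dist p P.f)
    (min (l1Dist p P.t + P.length / v + l1Dist P.t' P.f)
      (l1Dist p P.t' + P.length / v + l1Dist P.t P.f))

/-- The largest travel time from one of the `n ≥ 1` client points `S 0, …, S (n - 1)`. -/
def Placement.radius (P : Placement) (v : ℝ) {n : ℕ} [NeZero n] (S : Fin n → ℝ × ℝ) : ℝ :=
  Finset.univ.sup' Finset.univ_nonempty fun i => P.travelTime v (S i)

/-- Optimal solutions of the fixed-length problem with turnpike length `ℓ`. -/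
def IsOptimalFL (v ℓ : ℝ) {n : ℕ} [NeZero n] (S : Fin n → ℝ × ℝ) (P : Placement) : Prop :=
  P.length = ℓ ∧ ∀ Q : Placement, Q.length = ℓ → P.radius v S ≤ Q.radius v S

/-- Optimal solutions of the variable-length problem. -/
def IsOptimalVL (v : ℝ) {n : ℕ} [NeZero n] (S : Fin n → ℝ × ℝ) (P : Placement) : Prop :=
  ∀ Q : Placement, P.radius v S ≤ Q.radius v S

open RealRAM

/-- The initial state: index register `0` holds `n`, real registers `0` and `1` hold `v` and `ℓ`,
arrays `0` and `1` hold the abscissas and the ordinates of the clients; all other cells are `0`. -/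
def input (v ℓ : ℝ) {n : ℕ} (S : Fin n → ℝ × ℝ) : State where
  idx i := if i = 0 then n else 0
  reg r := if r = 0 then v else if r = 1 then ℓ else 0
  arr a k := if h : k < n then
      if a = 0 then (S ⟨k, h⟩).1 else if a = 1 then (S ⟨k, h⟩).2 else 0
    else 0

/-- The answer is read off the real registers `0, …, 5`. -/
def output (σ : State) : Placement where
  f := (σ.reg 0, σ.reg 1)
  t := (σ.reg 2, σ.reg 3)
  t' := (σ.reg 4, σ.reg 5)

/-- The program `A` solves the fixed-length problem on every instance with `n ≥ 1` clients in at most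
`T n` steps, with arrays of `M n` cells. -/
def SolvesFL (A : Prog) (T M : ℕ → ℕ) : Prop :=
  ∀ (n : ℕ) [NeZero n] (S : Fin n → ℝ × ℝ) (v ℓ : ℝ), 1 < v → 0 ≤ ℓ →
    ∃ (k : ℕ) (τ : State), Exec (M n) A (input v ℓ S) k τ ∧ k ≤ T n ∧
      IsOptimalFL v ℓ S (output τ)

/-- The program `A` solves the variable-length problem on every instance with `n ≥ 1` clients in at
most `T n` steps, with arrays of `M n` cells. No length is given: real register `1` starts at `0`. -/
def SolvesVL (A : Prog) (T M : ℕ → ℕ) : Prop :=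
  ∀ (n : ℕ) [NeZero n] (S : Fin n → ℝ × ℝ) (v : ℝ), 1 < v →
    ∃ (k : ℕ) (τ : State), Exec (M n) A (input v 0 S) k τ ∧ k ≤ T n ∧
      IsOptimalVL v S (output τ)

end Turnpike

end

/-!
The facility may be assumed to be an endpoint of the turnpike: only the direction that leads to the
end closer to the facility is ever worth riding, and translating the turnpike so that this end
meets the facility slows nobody down (`Placement.exists_facility_at_end`). In the coordinates
`x + y` and `x - y` walking distances are `L∞` distances. So the clients have to be covered by a
square of half side `R` around the facility `f` and a square of half side `R - len / v` around the
other endpoint `t`, where `len` is the length of the turnpike, and `R` is to be minimized.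

Only quadratically many partitions of the clients matter (`exists_partition`). If one of the two
squares contains both a leftmost or rightmost and a lowest or highest client, then, up to
reflections, the bounding box of its clients is the lower left corner of the bounding box of all
clients that is cut off by the abscissa of some client `i` and the ordinate of some client `j`, and
all clients outside of this corner lie in the other square. If neither square does, then one of them
spans all abscissas and the other one all ordinates, and the larger one is so large that all clients
may as well walk. The bounding box of the clients outside of the corner is the join of the boxes of
the clients to the right of `i` and of the clients above `j`. These boxes take linear time for each
`i` and each `j`, and those of the `j` are stored, which gives quadratic time and linear space.

For a given partition only two boxes remain, and the optimum is given by an expression. The offset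
`t - f` has to lie in a box that grows with `R`.
* For a fixed length, this box has to contain a point at a given distance from the origin. This holds
  if and only if its nearest point is not too far and its farthest point is not too close, and both
  conditions are lower bounds on `R` (`nearThreshold_le_iff`, `farThreshold_le_iff`).
* For a variable length and `v > 1`, it is best that the clients of the turnpike have to walk as
  little as the size of their box allows, because the time saved buys a longer turnpike. A condition
  on the nearest point of the box remains (`growthThreshold_le_iff`).

The program is verified with a total correctness logic, `Runs`, with a time bound that is computed
from the text of the program and is a polynomial whose degree is the nesting depth of the loops
(`Prog.exists_timeBound_le`). Both problems are solved by the same program, up to the five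
expressions that solve the problem for two boxes.
-/

/-! ### Reasoning about programs of the real RAM -/

namespace RealRAM

/-- The number of steps of a program in which every loop makes at most `n` iterations. -/
def Prog.timeBound (n : ℕ) : Prog → ℕ
  | .skip => 1
  | .setIdx _ e => e.cost + 1
  | .setReg _ e => e.cost + 1
  | .load _ _ e => e.cost + 1
  | .store _ e x => e.cost + x.cost + 1
  | .seq p q => p.timeBound n + q.timeBound n
  | .branch c p q => c.cost + 1 + (p.timeBound n + q.timeBound n)
  | .loop c p => n * (c.cost + 1 + p.timeBound n) + (c.cost + 1)

/-- The nesting depth of the loops. -/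
def Prog.depth : Prog → ℕ
  | .seq p q => max p.depth q.depth
  | .branch _ p q => max p.depth q.depth
  | .loop _ p => p.depth + 1
  | _ => 0

theorem Prog.exists_timeBound_le (p : Prog) :
    ∃ C : ℕ, ∀ n, p.timeBound n ≤ C * (n + 1) ^ p.depth := by
  have key (C d e n : ℕ) (h : d ≤ e) : C * (n + 1) ^ d ≤ C * (n + 1) ^ e :=
    Nat.mul_le_mul_left _ (Nat.pow_le_pow_right (Nat.succ_pos n) h)
  have one_le (d n : ℕ) : 1 ≤ (n + 1) ^ d := Nat.one_le_pow _ _ (Nat.succ_pos n)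
  induction p with
  | skip => exact ⟨1, fun n => by simp [timeBound, depth]⟩
  | setIdx i e => exact ⟨e.cost + 1, fun n => by simp [timeBound, depth]⟩
  | setReg r e => exact ⟨e.cost + 1, fun n => by simp [timeBound, depth]⟩
  | load r a e => exact ⟨e.cost + 1, fun n => by simp [timeBound, depth]⟩
  | store a e x => exact ⟨e.cost + x.cost + 1, fun n => by simp [timeBound, depth]⟩
  | seq p q hp hq =>
    obtain ⟨C, hC⟩ := hp
    obtain ⟨D, hD⟩ := hq
    refine ⟨C + D, fun n => ?_⟩
    have h1 := (hC n).trans (key C _ _ n (le_max_left p.depth q.depth))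
    have h2 := (hD n).trans (key D _ _ n (le_max_right p.depth q.depth))
    simp only [timeBound, depth, add_mul]
    exact add_le_add h1 h2
  | branch c p q hp hq =>
    obtain ⟨C, hC⟩ := hp
    obtain ⟨D, hD⟩ := hq
    refine ⟨c.cost + 1 + (C + D), fun n => ?_⟩
    have h1 := (hC n).trans (key C _ _ n (le_max_left p.depth q.depth))
    have h2 := (hD n).trans (key D _ _ n (le_max_right p.depth q.depth))
    simp only [timeBound, depth, add_mul (c.cost + 1), add_mul C]
    exact add_le_add (Nat.le_mul_of_pos_right _ (one_le _ n)) (add_le_add h1 h2)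
  | loop c p hp =>
    obtain ⟨C, hC⟩ := hp
    refine ⟨(c.cost + 1) + (c.cost + 1 + C), fun n => ?_⟩
    have h1 : c.cost + 1 + p.timeBound n ≤ (c.cost + 1 + C) * (n + 1) ^ p.depth := by
      rw [add_mul]
      exact add_le_add (Nat.le_mul_of_pos_right _ (one_le _ n)) (hC n)
    have h2 : n * (c.cost + 1 + p.timeBound n) ≤ (c.cost + 1 + C) * (n + 1) ^ (p.depth + 1) := by
      calc n * (c.cost + 1 + p.timeBound n)
          ≤ (n + 1) * ((c.cost + 1 + C) * (n + 1) ^ p.depth) :=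
            Nat.mul_le_mul (Nat.le_succ n) h1
        _ = _ := by ring
    simp only [timeBound, depth]
    rw [add_mul (c.cost + 1), add_comm]
    exact add_le_add (Nat.le_mul_of_pos_right _ (one_le _ n)) h2

theorem Prog.timeBound_isBigO (p : Prog) (hp : p.depth ≤ 2) :
    (fun n => (p.timeBound n : ℝ)) =O[atTop] (fun n : ℕ => (n : ℝ) ^ 2) := by
  obtain ⟨C, hC⟩ := p.exists_timeBound_le
  refine IsBigO.of_bound (4 * C) ?_
  filter_upwards [eventually_ge_atTop 1] with n hn
  have h1 : p.timeBound n ≤ C * (n + 1) ^ 2 :=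
    (hC n).trans (Nat.mul_le_mul_left _ (Nat.pow_le_pow_right (Nat.succ_pos n) hp))
  have h2 : C * (n + 1) ^ 2 ≤ 4 * C * n ^ 2 := by
    have : (n + 1) ^ 2 ≤ 4 * n ^ 2 := by nlinarith
    calc C * (n + 1) ^ 2 ≤ C * (4 * n ^ 2) := Nat.mul_le_mul_left _ this
      _ = _ := by ring
  have h3 : (p.timeBound n : ℝ) ≤ 4 * C * (n : ℝ) ^ 2 := by exact_mod_cast h1.trans h2
  simpa using h3

/-- The real registers that a program may change. -/
def Prog.modReg : Prog → List ℕ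
  | .setReg r _ => [r]
  | .load r _ _ => [r]
  | .seq p q => p.modReg ++ q.modReg
  | .branch _ p q => p.modReg ++ q.modReg
  | .loop _ p => p.modReg
  | _ => []

/-- The index registers that a program may change. -/
def Prog.modIdx : Prog → List ℕ
  | .setIdx i _ => [i]
  | .seq p q => p.modIdx ++ q.modIdx
  | .branch _ p q => p.modIdx ++ q.modIdx
  | .loop _ p => p.modIdx
  | _ => []

/-- The arrays that a program may change. -/
def Prog.modArr : Prog → List ℕ
  | .store a _ _ => [a]
  | .seq p q => p.modArr ++ q.modArr
  | .branch _ p q => p.modArr ++ q.modArr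
  | .loop _ p => p.modArr
  | _ => []

/-- `σ` and `τ` agree outside the registers and arrays that `p` may change. -/
structure Frame (p : Prog) (σ τ : State) : Prop where
  reg : ∀ r, r ∉ p.modReg → τ.reg r = σ.reg r
  idx : ∀ i, i ∉ p.modIdx → τ.idx i = σ.idx i
  arr : ∀ a, a ∉ p.modArr → τ.arr a = σ.arr a

theorem Exec.frame {m : ℕ} {p : Prog} {σ τ : State} {k : ℕ} (h : Exec m p σ k τ) :
    Frame p σ τ := by
  induction h with
  | skip σ => exact ⟨fun _ _ => rfl, fun _ _ => rfl, fun _ _ => rfl⟩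
  | setIdx σ i e =>
    exact ⟨fun _ _ => rfl, fun j hj => by simp_all [Prog.modIdx], fun _ _ => rfl⟩
  | setReg σ r e =>
    exact ⟨fun j hj => by simp_all [Prog.modReg], fun _ _ => rfl, fun _ _ => rfl⟩
  | load σ r a e h =>
    exact ⟨fun j hj => by simp_all [Prog.modReg], fun _ _ => rfl, fun _ _ => rfl⟩
  | store σ a e x h =>
    exact ⟨fun _ _ => rfl, fun _ _ => rfl, fun j hj => by simp_all [Prog.modArr]⟩
  | seq hp hq ihp ihq =>
    refine ⟨fun r hr => ?_, fun r hr => ?_, fun r hr => ?_⟩ <;>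
      simp only [Prog.modReg, Prog.modIdx, Prog.modArr, List.mem_append, not_or] at hr
    · rw [ihq.reg r hr.2, ihp.reg r hr.1]
    · rw [ihq.idx r hr.2, ihp.idx r hr.1]
    · rw [ihq.arr r hr.2, ihp.arr r hr.1]
  | branchTrue hc hp ih =>
    refine ⟨fun r hr => ?_, fun r hr => ?_, fun r hr => ?_⟩ <;>
      simp only [Prog.modReg, Prog.modIdx, Prog.modArr, List.mem_append, not_or] at hr
    · exact ih.reg r hr.1
    · exact ih.idx r hr.1
    · exact ih.arr r hr.1
  | branchFalse hc hp ih =>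
    refine ⟨fun r hr => ?_, fun r hr => ?_, fun r hr => ?_⟩ <;>
      simp only [Prog.modReg, Prog.modIdx, Prog.modArr, List.mem_append, not_or] at hr
    · exact ih.reg r hr.2
    · exact ih.idx r hr.2
    · exact ih.arr r hr.2
  | loopTrue hc hp hl ihp ihl =>
    exact ⟨fun r hr => (ihl.reg r hr).trans (ihp.reg r hr),
      fun r hr => (ihl.idx r hr).trans (ihp.idx r hr),
      fun r hr => (ihl.arr r hr).trans (ihp.arr r hr)⟩
  | loopFalse hc => exact ⟨fun _ _ => rfl, fun _ _ => rfl, fun _ _ => rfl⟩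

/-- Total correctness with a time bound, on a machine with arrays of `n` cells: started in `σ`, the
program `p` terminates within `p.timeBound n` steps in a state that satisfies `Q`. -/
def Runs (n : ℕ) (p : Prog) (σ : State) (Q : State → Prop) : Prop :=
  ∃ k τ, Exec n p σ k τ ∧ k ≤ p.timeBound n ∧ Q τ

namespace Runs

variable {n : ℕ} {p q : Prog} {σ : State} {Q Q' : State → Prop}

theorem mono (h : Runs n p σ Q) (hQ : ∀ τ, Frame p σ τ → Q τ → Q' τ) : Runs n p σ Q' := by
  obtain ⟨k, τ, he, hk, hτ⟩ := h
  exact ⟨k, τ, he, hk, hQ τ he.frame hτ⟩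

theorem skip (h : Q σ) : Runs n .skip σ Q := ⟨_, _, .skip σ, le_rfl, h⟩

theorem setReg {r : ℕ} {e : RExpr}
    (h : Q { σ with reg := Function.update σ.reg r (e.eval σ) }) : Runs n (.setReg r e) σ Q :=
  ⟨_, _, .setReg σ r e, le_rfl, h⟩

theorem load {r a : ℕ} {e : IExpr} (he : e.eval σ < n)
    (h : Q { σ with reg := Function.update σ.reg r (σ.arr a (e.eval σ)) }) :
    Runs n (.load r a e) σ Q :=
  ⟨_, _, .load σ r a e he, le_rfl, h⟩

theorem store {a : ℕ} {e : IExpr} {x : RExpr} (he : e.eval σ < n)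
    (h : Q { σ with
      arr := Function.update σ.arr a (Function.update (σ.arr a) (e.eval σ) (x.eval σ)) }) :
    Runs n (.store a e x) σ Q :=
  ⟨_, _, .store σ a e x he, le_rfl, h⟩

theorem seq (h : Runs n p σ fun τ => Runs n q τ Q) : Runs n (.seq p q) σ Q := by
  obtain ⟨k, τ, he, hk, l, ρ, hl, hle, hρ⟩ := h
  exact ⟨_, _, .seq he hl, add_le_add hk hle, hρ⟩

theorem branch {c : Cond} (hp : c.Holds σ → Runs n p σ Q) (hq : ¬ c.Holds σ → Runs n q σ Q) :
    Runs n (.branch c p q) σ Q := by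
  by_cases hc : c.Holds σ
  · obtain ⟨k, τ, he, hk, hτ⟩ := hp hc
    refine ⟨_, _, .branchTrue hc he, ?_, hτ⟩
    simp only [Prog.timeBound]
    omega
  · obtain ⟨k, τ, he, hk, hτ⟩ := hq hc
    refine ⟨_, _, .branchFalse hc he, ?_, hτ⟩
    simp only [Prog.timeBound]
    omega

end Runs

/-- Run `p` with index register `i` going through `0, …, n - 1`, where index register `0`
holds `n`. -/
def forLoop (i : ℕ) (p : Prog) : Prog :=
  .seq (.setIdx i (.const 0))
    (.loop (.idxLt (.var i) (.var 0)) (.seq p (.setIdx i (.succ (.var i)))))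

/-- The rule for counting loops, with an invariant that depends on the real registers and the
arrays only. -/
theorem Runs.forLoop {n i : ℕ} {p : Prog} {σ : State} (I : ℕ → State → Prop)
    (hI : ∀ k τ τ', τ'.reg = τ.reg → τ'.arr = τ.arr → I k τ → I k τ')
    (hn : σ.idx 0 = n) (hi : i ≠ 0) (hpi : i ∉ p.modIdx) (hp0 : 0 ∉ p.modIdx) (h0 : I 0 σ)
    (hstep : ∀ k < n, ∀ τ, τ.idx i = k → Frame (forLoop i p) σ τ → I k τ →
      Runs n p τ (I (k + 1))) :
    Runs n (forLoop i p) σ (I n) := by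
  have frame0 : ∀ τ τ' : State, Frame (RealRAM.forLoop i p) σ τ → Frame p τ τ' →
      Frame (RealRAM.forLoop i p) σ τ' := fun τ τ' h h' =>
    ⟨fun r hr => (h'.reg r (by simpa [RealRAM.forLoop, Prog.modReg] using hr)).trans (h.reg r hr),
      fun r hr => (h'.idx r (by
        simp only [RealRAM.forLoop, Prog.modIdx, List.mem_append, not_or] at hr
        exact hr.2.1)).trans (h.idx r hr),
      fun r hr => (h'.arr r (by simpa [RealRAM.forLoop, Prog.modArr] using hr)).trans (h.arr r hr)⟩
  have hi_mem : i ∈ (RealRAM.forLoop i p).modIdx := by simp [RealRAM.forLoop, Prog.modIdx]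
  have h0_mem : 0 ∉ (RealRAM.forLoop i p).modIdx := by
    simp [RealRAM.forLoop, Prog.modIdx, hp0, hi.symm]
  have frame1 : ∀ (τ : State) (x : ℕ), Frame (RealRAM.forLoop i p) σ τ →
      Frame (RealRAM.forLoop i p) σ { τ with idx := Function.update τ.idx i x } := fun τ x h =>
    ⟨h.reg, fun r hr => by
      have : r ≠ i := fun h => hr (h ▸ hi_mem)
      simpa [this] using h.idx r hr, h.arr⟩
  set c : Cond := .idxLt (.var i) (.var 0) with hc
  set b : Prog := .seq p (.setIdx i (.succ (.var i))) with hb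
  -- the loop started with `d` iterations to go
  have main : ∀ d k τ, k + d = n → τ.idx i = k → Frame (RealRAM.forLoop i p) σ τ → I k τ →
      ∃ l ρ, Exec n (.loop c b) τ l ρ ∧ l ≤ d * (c.cost + 1 + b.timeBound n) + (c.cost + 1) ∧
        I n ρ := by
    intro d
    induction d with
    | zero =>
      intro k τ hk hτ hf hIk
      have hkn : k = n := by omega
      subst hkn
      refine ⟨_, τ, .loopFalse ?_, by simp, hIk⟩
      simp [hc, Cond.Holds, IExpr.eval, hτ, hf.idx 0 h0_mem, hn]
    | succ d ih =>
      intro k τ hk hτ hf hIk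
      obtain ⟨l, ρ, he, hl, hρ⟩ := hstep k (by omega) τ hτ hf hIk
      have hρi : ρ.idx i = k := by rw [he.frame.idx i hpi, hτ]
      obtain ⟨l', ρ', he', hl', hρ'⟩ := ih (k + 1)
        { ρ with idx := Function.update ρ.idx i (k + 1) } (by omega) (by simp)
        (frame1 _ _ (frame0 _ _ hf he.frame)) (hI _ ρ _ rfl rfl hρ)
      have hs := Exec.setIdx (m := n) ρ i (.succ (.var i))
      simp only [IExpr.eval, hρi] at hs
      refine ⟨_, ρ', .loopTrue ?_ (.seq he hs) he', ?_, hρ'⟩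
      · simp only [hc, Cond.Holds, IExpr.eval, hτ, hf.idx 0 h0_mem, hn]
        omega
      · have : b.timeBound n = p.timeBound n + ((IExpr.succ (.var i)).cost + 1) := rfl
        rw [this] at hl' ⊢
        rw [add_mul d 1]
        omega
  have hσ : Frame (RealRAM.forLoop i p) σ { σ with idx := Function.update σ.idx i 0 } :=
    frame1 σ 0 ⟨fun _ _ => rfl, fun _ _ => rfl, fun _ _ => rfl⟩
  obtain ⟨l, ρ, he, hl, hρ⟩ := main n 0 { σ with idx := Function.update σ.idx i 0 } (by omega)
    (by simp) hσ (hI _ σ _ rfl rfl h0)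
  exact ⟨_, ρ, .seq (.setIdx σ i (.const 0)) he, add_le_add le_rfl hl, hρ⟩

/-! ### Functions computed by expressions -/

/-- A function of the state that is the value of an expression over the real registers. -/
def Expressible (g : State → ℝ) : Prop := ∃ e : RExpr, ∀ σ, e.eval σ = g σ

namespace Expressible

variable {f g h : State → ℝ}

theorem rat (q : ℚ) : Expressible fun _ => (q : ℝ) := ⟨.const q, fun _ => rfl⟩

theorem zero : Expressible fun _ => (0 : ℝ) := by simpa using rat 0

theorem one : Expressible fun _ => (1 : ℝ) := by simpa using rat 1

theorem ofNat (k : ℕ) [k.AtLeastTwo] : Expressible fun _ => (OfNat.ofNat k : ℝ) := by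
  simpa using rat (OfNat.ofNat k)

theorem reg (r : ℕ) : Expressible fun σ => σ.reg r := ⟨.reg r, fun _ => rfl⟩

theorem add (hf : Expressible f) (hg : Expressible g) : Expressible fun σ => f σ + g σ := by
  obtain ⟨a, ha⟩ := hf
  obtain ⟨b, hb⟩ := hg
  exact ⟨.add a b, fun σ => by simp [RExpr.eval, ha, hb]⟩

theorem sub (hf : Expressible f) (hg : Expressible g) : Expressible fun σ => f σ - g σ := by
  obtain ⟨a, ha⟩ := hf
  obtain ⟨b, hb⟩ := hg
  exact ⟨.sub a b, fun σ => by simp [RExpr.eval, ha, hb]⟩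

theorem mul (hf : Expressible f) (hg : Expressible g) : Expressible fun σ => f σ * g σ := by
  obtain ⟨a, ha⟩ := hf
  obtain ⟨b, hb⟩ := hg
  exact ⟨.mul a b, fun σ => by simp [RExpr.eval, ha, hb]⟩

theorem div (hf : Expressible f) (hg : Expressible g) : Expressible fun σ => f σ / g σ := by
  obtain ⟨a, ha⟩ := hf
  obtain ⟨b, hb⟩ := hg
  exact ⟨.div a b, fun σ => by simp [RExpr.eval, ha, hb]⟩

theorem sqrt (hf : Expressible f) : Expressible fun σ => Real.sqrt (f σ) := by
  obtain ⟨a, ha⟩ := hf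
  exact ⟨.sqrt a, fun σ => by simp [RExpr.eval, ha]⟩

theorem neg (hf : Expressible f) : Expressible fun σ => -f σ := by
  simpa using zero.sub hf

theorem sq (hf : Expressible f) : Expressible fun σ => f σ ^ 2 := by
  simpa [pow_two] using hf.mul hf

theorem abs (hf : Expressible f) : Expressible fun σ => |f σ| := by
  simpa [Real.sqrt_sq_eq_abs] using hf.sq.sqrt

theorem max (hf : Expressible f) (hg : Expressible g) : Expressible fun σ => max (f σ) (g σ) := by
  have h := ((hf.add hg).add (hf.sub hg).abs).div (ofNat 2)
  convert h using 2 with σ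
  rcases le_total (f σ) (g σ) with h | h
  · rw [max_eq_right h, abs_of_nonpos (by linarith)]
    ring
  · rw [max_eq_left h, abs_of_nonneg (by linarith)]
    ring

theorem min (hf : Expressible f) (hg : Expressible g) : Expressible fun σ => min (f σ) (g σ) := by
  have h := (hf.neg.max hg.neg).neg
  simpa [max_neg_neg] using h

/-- Case distinctions: the quotient `max f 0 / max f 0` is the indicator function of `0 < f`. -/
theorem ite_pos (hf : Expressible f) (hg : Expressible g) (hh : Expressible h) :
    Expressible fun σ => if 0 < f σ then g σ else h σ := by
  have hi := (hf.max zero).div (hf.max zero)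
  convert (hi.mul hg).add ((one.sub hi).mul hh) using 2 with σ
  split_ifs with h0
  · simp [max_eq_left h0.le, h0.ne']
  · simp [max_eq_right (not_lt.mp h0)]

end Expressible

end RealRAM

/-! ### The distance between a point of one box and a point of another -/

namespace Turnpike

/-- The point of the interval `[a, b]` that is nearest to `0`. -/
noncomputable def nearPoint (a b : ℝ) : ℝ := max a (min 0 b)

/-- The point of the interval `[a, b]` that is farthest from `0`. -/
noncomputable def farPoint (a b : ℝ) : ℝ := if 0 < a + b then b else a

theorem nearPoint_mem {a b : ℝ} (h : a ≤ b) : a ≤ nearPoint a b ∧ nearPoint a b ≤ b :=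
  ⟨le_max_left _ _, max_le h (min_le_right _ _)⟩

theorem farPoint_mem {a b : ℝ} (h : a ≤ b) : a ≤ farPoint a b ∧ farPoint a b ≤ b := by
  unfold farPoint
  split_ifs <;> simp [h]

theorem nearPoint_sq_le {a b : ℝ} (h : a ≤ b) : nearPoint a b ^ 2 ≤ max 0 (max a (-b)) ^ 2 := by
  refine sq_le_sq' ?_ ?_ <;> unfold nearPoint
  · rcases le_total 0 b with hb | hb
    · rw [min_eq_left hb]
      linarith [le_max_right a 0, le_max_left 0 (max a (-b))]
    · rw [min_eq_right hb, max_eq_right h]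
      linarith [le_max_right a (-b), le_max_right 0 (max a (-b))]
  · refine max_le ((le_max_left _ _).trans (le_max_right _ _)) ?_
    exact (min_le_left _ _).trans (le_max_left _ _)

theorem le_farPoint_sq (a b : ℝ) : max (-a) b ^ 2 ≤ farPoint a b ^ 2 := by
  rw [sq_le_sq]
  unfold farPoint
  split_ifs with h0
  · rw [max_eq_right (by linarith)]
  · rw [max_eq_left (by linarith), abs_neg]

/-- For `s + p, s + q ≥ 0`, the condition `2 ℓ² ≤ (s + p)² + (s + q)²` says that `s` is at least this
number. If the radicand is negative, the condition always holds, and so does the bound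
`-(p + q) / 2 ≤ s` that results from the convention for square roots. -/
noncomputable def farThreshold (p q ℓ : ℝ) : ℝ := (-(p + q) + Real.sqrt (4 * ℓ ^ 2 - (p - q) ^ 2)) / 2

theorem farThreshold_le_iff {p q ℓ s : ℝ} (hp : 0 ≤ s + p) (hq : 0 ≤ s + q) :
    farThreshold p q ℓ ≤ s ↔ 2 * ℓ ^ 2 ≤ (s + p) ^ 2 + (s + q) ^ 2 := by
  have h1 : farThreshold p q ℓ ≤ s ↔
      Real.sqrt (4 * ℓ ^ 2 - (p - q) ^ 2) ≤ (s + p) + (s + q) := by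
    unfold farThreshold
    constructor <;> intro h <;> linarith
  rw [h1, Real.sqrt_le_iff]
  constructor
  · rintro ⟨-, h⟩
    nlinarith
  · intro h
    exact ⟨by linarith, by nlinarith⟩

/-- The least `s` with `max 0 (P - s) ² + max 0 (Q - s) ² ≤ 2 ℓ²`. If `P` and `Q` differ by at most
`√2 ℓ`, this is a root of the quadratic without truncation, and otherwise `max P Q - √2 ℓ`, which is
the same expression with `√2 ℓ` in the place of `|P - Q|`. -/
noncomputable def nearThreshold (P Q ℓ : ℝ) : ℝ :=
  max P Q - (min |P - Q| (Real.sqrt 2 * ℓ) +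
    Real.sqrt (4 * ℓ ^ 2 - min |P - Q| (Real.sqrt 2 * ℓ) ^ 2)) / 2

theorem nearThreshold_comm (P Q ℓ : ℝ) : nearThreshold P Q ℓ = nearThreshold Q P ℓ := by
  unfold nearThreshold
  rw [abs_sub_comm, max_comm]

theorem nearThreshold_le_iff {P Q ℓ s : ℝ} (hℓ : 0 ≤ ℓ) :
    nearThreshold P Q ℓ ≤ s ↔ max 0 (P - s) ^ 2 + max 0 (Q - s) ^ 2 ≤ 2 * ℓ ^ 2 := by
  wlog hPQ : Q ≤ P generalizing P Q
  · rw [nearThreshold_comm, this (le_of_not_ge hPQ), add_comm]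
  have hr : Real.sqrt 2 ^ 2 = 2 := Real.sq_sqrt (by norm_num)
  obtain ⟨L, hL⟩ : ∃ L, L = Real.sqrt 2 * ℓ := ⟨_, rfl⟩
  have hL0 : 0 ≤ L := hL ▸ by positivity
  have hL2 : L ^ 2 = 2 * ℓ ^ 2 := by rw [hL, mul_pow, hr]
  unfold nearThreshold
  rw [max_eq_left hPQ, abs_of_nonneg (by linarith), ← hL]
  obtain ⟨δ, hδ⟩ : ∃ δ, δ = min (P - Q) L := ⟨_, rfl⟩
  have hδ0 : 0 ≤ δ := hδ ▸ le_min (by linarith) hL0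
  have hδ1 : δ ≤ P - Q := hδ ▸ min_le_left _ _
  have hδL : δ ≤ L := hδ ▸ min_le_right _ _
  rw [← hδ]
  have hδ2 : δ ^ 2 ≤ L ^ 2 := pow_le_pow_left₀ hδ0 hδL 2
  have hh := Real.sq_sqrt (show 0 ≤ 4 * ℓ ^ 2 - δ ^ 2 by nlinarith)
  have hLh : L ≤ Real.sqrt (4 * ℓ ^ 2 - δ ^ 2) := Real.le_sqrt_of_sq_le (by linarith)
  obtain ⟨z, hz⟩ : ∃ z, z = (δ + Real.sqrt (4 * ℓ ^ 2 - δ ^ 2)) / 2 := ⟨_, rfl⟩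
  have hzδ : δ ≤ z := by linarith
  have hz2 : z ^ 2 + (z - δ) ^ 2 = 2 * ℓ ^ 2 := by
    rw [hz]
    linear_combination hh / 2
  rw [← hz]
  constructor
  · intro h
    rw [← hz2]
    refine add_le_add ?_ ?_
    · exact pow_le_pow_left₀ (le_max_left _ _) (max_le (by linarith) (by linarith)) 2
    · exact pow_le_pow_left₀ (le_max_left _ _) (max_le (by linarith) (by linarith)) 2
  · contrapose!
    intro h
    rw [max_eq_right (show 0 ≤ P - s by linarith)]
    have h1 : z ^ 2 < (P - s) ^ 2 := pow_lt_pow_left₀ (by linarith) (by linarith) two_ne_zero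
    rcases le_total (P - Q) L with hc | hc
    · have hd : δ = P - Q := hδ.trans (min_eq_left hc)
      have h2 : (z - δ) ^ 2 ≤ max 0 (Q - s) ^ 2 :=
        pow_le_pow_left₀ (by linarith) (le_max_of_le_right (by linarith)) 2
      linarith
    · have hd : δ = L := hδ.trans (min_eq_right hc)
      have h2 : L ^ 2 ≤ z ^ 2 := pow_le_pow_left₀ hL0 (by linarith) 2
      have h3 := sq_nonneg (max 0 (Q - s))
      linarith

/-- The parameter in `[0, 1]` at which the segment from `m` to `M` leaves a disc, where
`A = |M - m|²`, `B = m ⬝ (M - m)` and `C` is the power of `m` with respect to the circle. For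
`A = 0` it is `0`. -/
noncomputable def crossing (A B C : ℝ) : ℝ := (-B + Real.sqrt (B ^ 2 - A * C)) / A

theorem crossing_spec {A B C : ℝ} (hA : 0 ≤ A) (hAB : A = 0 → B = 0) (hC : C ≤ 0)
    (hM : 0 ≤ A + 2 * B + C) :
    0 ≤ crossing A B C ∧ crossing A B C ≤ 1 ∧
      A * crossing A B C ^ 2 + 2 * B * crossing A B C + C = 0 := by
  unfold crossing
  rcases hA.eq_or_lt with h0 | h0
  · have hB := hAB h0.symm
    subst h0 hB
    refine ⟨by simp, by simp, ?_⟩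
    simp only [div_zero]
    linarith
  · have hAC : A * C ≤ 0 := mul_nonpos_of_nonneg_of_nonpos hA hC
    have hD : 0 ≤ B ^ 2 - A * C := by nlinarith [sq_nonneg B]
    have hs := Real.sq_sqrt hD
    refine ⟨div_nonneg ?_ hA, ?_, ?_⟩
    · have : |B| ≤ Real.sqrt (B ^ 2 - A * C) := Real.abs_le_sqrt (by linarith)
      linarith [le_abs_self B]
    · rw [div_le_one h0]
      have hAB' : 0 ≤ A + B := by
        by_contra hneg
        linarith
      have : Real.sqrt (B ^ 2 - A * C) ≤ A + B := Real.sqrt_le_iff.mpr ⟨hAB', by nlinarith⟩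
      linarith
    · field_simp
      linear_combination hs

/-- The least `y ≥ 0` with `max 0 (P - y) ² + max 0 (Q - y) ² ≤ 2 v² y²`. Raising the smaller one of
`P` and `Q` to the solution `a / (1 + √2 v)` for the larger one alone does not change it, and makes
it a root of the quadratic without truncation. -/
noncomputable def growthThreshold (P Q v : ℝ) : ℝ :=
  let a := max (max P Q) 0
  let b := max (min P Q) (a / (1 + Real.sqrt 2 * v))
  (-(a + b) + Real.sqrt ((a + b) ^ 2 + 2 * (v ^ 2 - 1) * (a ^ 2 + b ^ 2))) / (2 * (v ^ 2 - 1))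

theorem growthThreshold_comm (P Q v : ℝ) : growthThreshold P Q v = growthThreshold Q P v := by
  unfold growthThreshold
  rw [max_comm P Q, min_comm P Q]

theorem growthThreshold_le_iff {P Q v y : ℝ} (hv : 1 < v) (hy : 0 ≤ y) :
    growthThreshold P Q v ≤ y ↔ max 0 (P - y) ^ 2 + max 0 (Q - y) ^ 2 ≤ 2 * v ^ 2 * y ^ 2 := by
  wlog hPQ : Q ≤ P generalizing P Q
  · rw [growthThreshold_comm, this (le_of_not_ge hPQ), add_comm]
  obtain ⟨ρ, hρ⟩ : ∃ ρ, ρ = Real.sqrt 2 * v := ⟨_, rfl⟩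
  have hρ0 : 0 < ρ := hρ ▸ by positivity
  have hρ2 : ρ ^ 2 = 2 * v ^ 2 := by rw [hρ, mul_pow, Real.sq_sqrt (by norm_num)]
  have hv2 : 0 < v ^ 2 - 1 := by nlinarith
  unfold growthThreshold
  rw [max_eq_left hPQ, min_eq_right hPQ, ← hρ]
  obtain ⟨a, ha⟩ : ∃ a, a = max P 0 := ⟨_, rfl⟩
  obtain ⟨y₁, hy₁⟩ : ∃ y₁, y₁ = a / (1 + ρ) := ⟨_, rfl⟩
  obtain ⟨b, hb⟩ : ∃ b, b = max Q y₁ := ⟨_, rfl⟩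
  simp only [← ha, ← hy₁, ← hb]
  have ha0 : 0 ≤ a := ha ▸ le_max_right _ _
  have hPa : P ≤ a := ha ▸ le_max_left _ _
  have hQb : Q ≤ b := hb ▸ le_max_left _ _
  have hyb : y₁ ≤ b := hb ▸ le_max_right _ _
  have ha1 : a = y₁ * (1 + ρ) := by rw [hy₁]; field_simp
  have hy10 : 0 ≤ y₁ := hy₁ ▸ div_nonneg ha0 (by linarith)
  -- the threshold is the positive root of the quadratic without truncation
  have hroot : (-(a + b) + Real.sqrt ((a + b) ^ 2 + 2 * (v ^ 2 - 1) * (a ^ 2 + b ^ 2))) /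
      (2 * (v ^ 2 - 1)) ≤ y ↔ (a - y) ^ 2 + (b - y) ^ 2 ≤ 2 * v ^ 2 * y ^ 2 := by
    rw [div_le_iff₀ (by linarith)]
    have h1 : -(a + b) + Real.sqrt ((a + b) ^ 2 + 2 * (v ^ 2 - 1) * (a ^ 2 + b ^ 2)) ≤
        y * (2 * (v ^ 2 - 1)) ↔
        Real.sqrt ((a + b) ^ 2 + 2 * (v ^ 2 - 1) * (a ^ 2 + b ^ 2)) ≤
        y * (2 * (v ^ 2 - 1)) + (a + b) := by
      constructor <;> intro h <;> linarith
    have hb0 : 0 ≤ b := hy10.trans hyb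
    have h0 : 0 ≤ y * (2 * (v ^ 2 - 1)) + (a + b) := by
      have := mul_nonneg hy hv2.le
      linarith
    have h2 : (y * (2 * (v ^ 2 - 1)) + (a + b)) ^ 2 -
        ((a + b) ^ 2 + 2 * (v ^ 2 - 1) * (a ^ 2 + b ^ 2)) =
        2 * (v ^ 2 - 1) * (2 * v ^ 2 * y ^ 2 - ((a - y) ^ 2 + (b - y) ^ 2)) := by ring
    rw [h1, Real.sqrt_le_iff]
    constructor
    · rintro ⟨-, h⟩
      have : 0 ≤ 2 * (v ^ 2 - 1) * (2 * v ^ 2 * y ^ 2 - ((a - y) ^ 2 + (b - y) ^ 2)) := by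
        linarith
      have := nonneg_of_mul_nonneg_right this (by linarith)
      linarith
    · intro h
      refine ⟨h0, ?_⟩
      have : 0 ≤ 2 * (v ^ 2 - 1) * (2 * v ^ 2 * y ^ 2 - ((a - y) ^ 2 + (b - y) ^ 2)) :=
        mul_nonneg (by linarith) (by linarith)
      linarith
  rw [hroot]
  constructor
  · intro h
    refine le_trans (add_le_add ?_ ?_) h <;> rw [sq_le_sq, abs_of_nonneg (le_max_left 0 _)]
    · exact max_le (abs_nonneg _) (le_trans (by linarith) (le_abs_self _))
    · exact max_le (abs_nonneg _) (le_trans (by linarith) (le_abs_self _))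
  · intro h
    have hP : (P - y) ≤ ρ * y := by
      refine (le_max_right 0 _).trans (le_of_abs_le (abs_le_of_sq_le_sq ?_ (by positivity)))
      rw [mul_pow, hρ2]
      linarith [sq_nonneg (max 0 (Q - y))]
    have hy1 : y₁ ≤ y := by
      rw [hy₁, div_le_iff₀ (by linarith), ha]
      exact max_le (by linarith) (by positivity)
    rcases le_or_gt a y with hay | hay
    · -- both coordinates are dominated by `y`
      have hb0 : 0 ≤ b := hy10.trans hyb
      have hby : b ≤ max a y := hb ▸ max_le ((hPQ.trans hPa).trans (le_max_left _ _))
        (hy1.trans (le_max_right _ _))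
      rw [max_eq_right hay] at hby
      nlinarith [mul_nonneg ha0 (sub_nonneg.mpr hay), mul_nonneg hb0 (sub_nonneg.mpr hby),
        sq_nonneg y, mul_nonneg hv2.le (sq_nonneg y)]
    · have haP : a = P := by
        rw [ha]
        refine max_eq_left (le_of_not_gt fun hneg => ?_)
        rw [ha, max_eq_right hneg.le] at hay
        linarith
      rcases lt_or_ge y b with hyb' | hyb'
      · have hbQ : b = Q := by
          rw [hb]
          refine max_eq_left (le_of_not_gt fun hneg => ?_)
          rw [hb, max_eq_right hneg.le] at hyb'
          linarith
        rwa [max_eq_right (by linarith), max_eq_right (by linarith), ← haP, ← hbQ] at h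
      · have h1 : (b - y) ^ 2 ≤ (y - y₁) ^ 2 := sq_le_sq' (by linarith) (by linarith)
        have h2 : (a - y) ^ 2 + (y - y₁) ^ 2 ≤ ρ ^ 2 * y ^ 2 := by
          have hv1 : 1 ≤ ρ ^ 2 / 2 := by rw [hρ2]; nlinarith
          obtain ⟨z, rfl⟩ : ∃ z, y = y₁ + z := ⟨y - y₁, by ring⟩
          have hz : 0 ≤ z := by linarith
          have e : ρ ^ 2 * (y₁ + z) ^ 2 - ((a - (y₁ + z)) ^ 2 + (y₁ + z - y₁) ^ 2) =
              2 * ρ * (y₁ * z) + 2 * ρ ^ 2 * (y₁ * z) + (ρ ^ 2 - 2) * z ^ 2 := by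
            rw [ha1]; ring
          have : 0 ≤ (ρ ^ 2 - 2) * z ^ 2 := mul_nonneg (by linarith) (sq_nonneg z)
          have : 0 ≤ 2 * ρ * (y₁ * z) + 2 * ρ ^ 2 * (y₁ * z) := by positivity
          linarith
        rw [← hρ2]
        linarith

end Turnpike

/-! ### Serving two boxes -/

namespace Turnpike

/-- The axis-parallel rectangle `[x1, x2] × [y1, y2]`. -/
structure Box where
  x1 : ℝ
  x2 : ℝ
  y1 : ℝ
  y2 : ℝ

/-- All points of the box are at `L∞` distance at most `R` from `f`. This is a condition on the
four sides, also when the box is empty. -/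
def Box.Within (b : Box) (f : ℝ × ℝ) (R : ℝ) : Prop :=
  b.x2 - R ≤ f.1 ∧ f.1 ≤ b.x1 + R ∧ b.y2 - R ≤ f.2 ∧ f.2 ≤ b.y1 + R

/-- The problem of serving all points of the box `W` by walking and all points of the box `B` by
the turnpike, in coordinates in which walking distances are `L∞` distances. -/
structure BoxProblem where
  W : Box
  B : Box
  v : ℝ
  ℓ : ℝ

/-- A radius, a facility `f`, which is also an endpoint of the turnpike, and the other
endpoint `t`. -/
structure BoxSolution where
  radius : ℝ
  f : ℝ × ℝ
  t : ℝ × ℝ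

/-- The turnpike from `t` to `f` has length `len` and brings the clients in `W` and in `B` to `f`
within time `R`. The coordinates are stretched by a factor `√2`. -/
def BoxProblem.Serves (D : BoxProblem) (f t : ℝ × ℝ) (R len : ℝ) : Prop :=
  D.W.Within f R ∧ D.B.Within t (R - len / D.v) ∧
    (t.1 - f.1) ^ 2 + (t.2 - f.2) ^ 2 = 2 * len ^ 2

/-- All parameters of the box problem `D` are values of expressions over the real registers. -/
structure ExpressibleProblem (D : RealRAM.State → BoxProblem) : Prop where
  wx1 : RealRAM.Expressible fun σ => (D σ).W.x1
  wx2 : RealRAM.Expressible fun σ => (D σ).W.x2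
  wy1 : RealRAM.Expressible fun σ => (D σ).W.y1
  wy2 : RealRAM.Expressible fun σ => (D σ).W.y2
  bx1 : RealRAM.Expressible fun σ => (D σ).B.x1
  bx2 : RealRAM.Expressible fun σ => (D σ).B.x2
  by1 : RealRAM.Expressible fun σ => (D σ).B.y1
  by2 : RealRAM.Expressible fun σ => (D σ).B.y2
  v : RealRAM.Expressible fun σ => (D σ).v
  ℓ : RealRAM.Expressible fun σ => (D σ).ℓ

/-- All coordinates of `s` are values of expressions over the real registers. -/
structure ExpressibleSolution (s : RealRAM.State → BoxSolution) : Prop where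
  radius : RealRAM.Expressible fun σ => (s σ).radius
  fx : RealRAM.Expressible fun σ => (s σ).f.1
  fy : RealRAM.Expressible fun σ => (s σ).f.2
  tx : RealRAM.Expressible fun σ => (s σ).t.1
  ty : RealRAM.Expressible fun σ => (s σ).t.2

/-- `solve` finds an optimal solution of every box problem by evaluating expressions, where
`Feas ℓ len` says that the length `len` is allowed. -/
structure IsSolver (Feas : ℝ → ℝ → Prop) (solve : BoxProblem → BoxSolution) : Prop where
  sound : ∀ D : BoxProblem, 1 < D.v → 0 ≤ D.ℓ → ∃ len, 0 ≤ len ∧ Feas D.ℓ len ∧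
    D.Serves (solve D).f (solve D).t (solve D).radius len
  optimal : ∀ (D : BoxProblem) (f t : ℝ × ℝ) (R len : ℝ), 1 < D.v → 0 ≤ D.ℓ → 0 ≤ len →
    Feas D.ℓ len → D.Serves f t R len → (solve D).radius ≤ R
  expressible : ∀ D, ExpressibleProblem D → ExpressibleSolution fun σ => solve (D σ)

/-- The solution of radius `R` with offset `t - f = (dx, dy)`, when the clients in `B` have to
walk at most a distance `r`. -/
def BoxProblem.place (D : BoxProblem) (R r dx dy : ℝ) : BoxSolution where
  radius := R
  f := (max (D.W.x2 - R) (D.B.x2 - r - dx), max (D.W.y2 - R) (D.B.y2 - r - dy))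
  t := (max (D.W.x2 - R) (D.B.x2 - r - dx) + dx, max (D.W.y2 - R) (D.B.y2 - r - dy) + dy)

theorem le_place {a1 a2 c1 c2 R r d : ℝ} (ha : a2 - a1 ≤ 2 * R) (hc : c2 - c1 ≤ 2 * r)
    (h1 : c2 - a1 - (R + r) ≤ d) (h2 : d ≤ c1 - a2 + (R + r)) :
    (a2 - R ≤ max (a2 - R) (c2 - r - d) ∧ max (a2 - R) (c2 - r - d) ≤ a1 + R) ∧
      c2 - r ≤ max (a2 - R) (c2 - r - d) + d ∧ max (a2 - R) (c2 - r - d) + d ≤ c1 + r := by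
  refine ⟨⟨le_max_left _ _, max_le (by linarith) (by linarith)⟩, ?_, ?_⟩
  · linarith [le_max_right (a2 - R) (c2 - r - d)]
  · rcases max_cases (a2 - R) (c2 - r - d) with h | h <;> linarith

theorem BoxProblem.place_within {D : BoxProblem} {R r dx dy : ℝ}
    (hWx : D.W.x2 - D.W.x1 ≤ 2 * R) (hWy : D.W.y2 - D.W.y1 ≤ 2 * R)
    (hBx : D.B.x2 - D.B.x1 ≤ 2 * r) (hBy : D.B.y2 - D.B.y1 ≤ 2 * r)
    (hx1 : D.B.x2 - D.W.x1 - (R + r) ≤ dx) (hx2 : dx ≤ D.B.x1 - D.W.x2 + (R + r))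
    (hy1 : D.B.y2 - D.W.y1 - (R + r) ≤ dy) (hy2 : dy ≤ D.B.y1 - D.W.y2 + (R + r)) :
    D.W.Within (D.place R r dx dy).f R ∧ D.B.Within (D.place R r dx dy).t r := by
  obtain ⟨⟨a, b⟩, c, d⟩ := le_place hWx hBx hx1 hx2
  obtain ⟨⟨a', b'⟩, c', d'⟩ := le_place hWy hBy hy1 hy2
  exact ⟨⟨a, b, a', b'⟩, c, d, c', d'⟩

/-! ### Two boxes and a turnpike of fixed length -/

/-- The point at distance `√2 ℓ` from the origin on the segment between two points. -/
noncomputable def circlePoint (mx my Mx My ℓ : ℝ) : ℝ × ℝ :=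
  let θ := crossing ((Mx - mx) ^ 2 + (My - my) ^ 2) (mx * (Mx - mx) + my * (My - my))
    (mx ^ 2 + my ^ 2 - 2 * ℓ ^ 2)
  (mx + θ * (Mx - mx), my + θ * (My - my))

theorem circlePoint_spec {mx my Mx My ℓ : ℝ} (hm : mx ^ 2 + my ^ 2 ≤ 2 * ℓ ^ 2)
    (hM : 2 * ℓ ^ 2 ≤ Mx ^ 2 + My ^ 2) :
    (∃ θ, 0 ≤ θ ∧ θ ≤ 1 ∧ circlePoint mx my Mx My ℓ =
      (mx + θ * (Mx - mx), my + θ * (My - my))) ∧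
    (circlePoint mx my Mx My ℓ).1 ^ 2 + (circlePoint mx my Mx My ℓ).2 ^ 2 = 2 * ℓ ^ 2 := by
  obtain ⟨h0, h1, h2⟩ := crossing_spec (A := (Mx - mx) ^ 2 + (My - my) ^ 2)
    (B := mx * (Mx - mx) + my * (My - my)) (C := mx ^ 2 + my ^ 2 - 2 * ℓ ^ 2) (by positivity)
    (fun h => by
      have hx : Mx - mx = 0 := by nlinarith [sq_nonneg (Mx - mx), sq_nonneg (My - my)]
      have hy : My - my = 0 := by nlinarith [sq_nonneg (Mx - mx), sq_nonneg (My - my)]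
      simp [hx, hy]) (by linarith) (by linarith)
  refine ⟨⟨_, h0, h1, rfl⟩, ?_⟩
  simp only [circlePoint]
  linear_combination h2

theorem convex_mem {a b m M θ : ℝ} (hm : a ≤ m ∧ m ≤ b) (hM : a ≤ M ∧ M ≤ b) (h0 : 0 ≤ θ)
    (h1 : θ ≤ 1) : a ≤ m + θ * (M - m) ∧ m + θ * (M - m) ≤ b := by
  constructor <;> nlinarith

/-- The possible abscissas of the offset `t - f` with radius `s / 2` are the numbers from
`offsetLo - s` to `offsetHi + s`, and similarly for the ordinates. Here `[a1, a2]` and `[c1, c2]`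
are the projections of the boxes `W` and `B`, and `c` is the travel time on the turnpike. -/
noncomputable def offsetLo (a1 c2 c : ℝ) : ℝ := c2 - a1 + c

/-- See `offsetLo`. -/
noncomputable def offsetHi (a2 c1 c : ℝ) : ℝ := c1 - a2 - c

/-- Twice the optimal radius of the box problem with a turnpike of length `ℓ`. -/
noncomputable def diameterFL (D : BoxProblem) : ℝ :=
  let lx := offsetLo D.W.x1 D.B.x2 (D.ℓ / D.v)
  let hx := offsetHi D.W.x2 D.B.x1 (D.ℓ / D.v)
  let ly := offsetLo D.W.y1 D.B.y2 (D.ℓ / D.v)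
  let hy := offsetHi D.W.y2 D.B.y1 (D.ℓ / D.v)
  max (max (max (D.W.x2 - D.W.x1) (D.W.y2 - D.W.y1))
      (max (D.B.x2 - D.B.x1) (D.B.y2 - D.B.y1) + 2 * (D.ℓ / D.v)))
    (max (farThreshold (max (-lx) hx) (max (-ly) hy) D.ℓ)
      (nearThreshold (max lx (-hx)) (max ly (-hy)) D.ℓ))

/-- The offset `t - f` of the computed solution: a point at distance `√2 ℓ` from the origin in the
box of the possible offsets. -/
noncomputable def offsetFL (D : BoxProblem) : ℝ × ℝ :=
  let s := diameterFL D
  let lx := offsetLo D.W.x1 D.B.x2 (D.ℓ / D.v) - s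
  let hx := offsetHi D.W.x2 D.B.x1 (D.ℓ / D.v) + s
  let ly := offsetLo D.W.y1 D.B.y2 (D.ℓ / D.v) - s
  let hy := offsetHi D.W.y2 D.B.y1 (D.ℓ / D.v) + s
  circlePoint (nearPoint lx hx) (nearPoint ly hy) (farPoint lx hx) (farPoint ly hy) D.ℓ

/-- The optimal solution of the box problem with a turnpike of length `ℓ`. -/
noncomputable def solveFL (D : BoxProblem) : BoxSolution :=
  D.place (diameterFL D / 2) (diameterFL D / 2 - D.ℓ / D.v) (offsetFL D).1 (offsetFL D).2

theorem add_max_neg_nonneg {l h s : ℝ} (hs : l - s ≤ h + s) : 0 ≤ s + max (-l) h := by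
  linarith [le_max_left (-l) h, le_max_right (-l) h]

theorem neg_sub_sup {l h s : ℝ} : max (-(l - s)) (h + s) = s + max (-l) h := by
  rw [← max_add_add_left]; ring_nf

theorem sub_sup_neg {l h s : ℝ} : max (l - s) (-(h + s)) = max l (-h) - s := by
  rw [← max_sub_sub_right]; ring_nf

theorem solveFL_sound (D : BoxProblem) (hℓ : 0 ≤ D.ℓ) :
    D.Serves (solveFL D).f (solveFL D).t (solveFL D).radius D.ℓ := by
  obtain ⟨s, hs⟩ : ∃ s, s = diameterFL D := ⟨_, rfl⟩
  have hs' := hs.symm.le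
  simp only [diameterFL, max_le_iff] at hs'
  obtain ⟨⟨⟨hwx, hwy⟩, hb⟩, hfar, hnear⟩ := hs'
  have hbx := le_max_left (D.B.x2 - D.B.x1) (D.B.y2 - D.B.y1)
  have hby := le_max_right (D.B.x2 - D.B.x1) (D.B.y2 - D.B.y1)
  have hoff : offsetFL D = offsetFL D := rfl
  conv_rhs at hoff => simp only [offsetFL, ← hs]
  obtain ⟨lx, hlx⟩ : ∃ l, l = offsetLo D.W.x1 D.B.x2 (D.ℓ / D.v) := ⟨_, rfl⟩
  obtain ⟨hx, hhx⟩ : ∃ l, l = offsetHi D.W.x2 D.B.x1 (D.ℓ / D.v) := ⟨_, rfl⟩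
  obtain ⟨ly, hly⟩ : ∃ l, l = offsetLo D.W.y1 D.B.y2 (D.ℓ / D.v) := ⟨_, rfl⟩
  obtain ⟨hy, hhy⟩ : ∃ l, l = offsetHi D.W.y2 D.B.y1 (D.ℓ / D.v) := ⟨_, rfl⟩
  rw [← hlx, ← hhx, ← hly, ← hhy] at hfar hnear hoff
  have hxs : lx - s ≤ hx + s := by rw [hlx, hhx, offsetLo, offsetHi]; linarith
  have hys : ly - s ≤ hy + s := by rw [hly, hhy, offsetLo, offsetHi]; linarith
  rw [farThreshold_le_iff (add_max_neg_nonneg hxs) (add_max_neg_nonneg hys), ← neg_sub_sup,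
    ← neg_sub_sup] at hfar
  rw [nearThreshold_le_iff hℓ, ← sub_sup_neg, ← sub_sup_neg] at hnear
  obtain ⟨⟨θ, h0, h1, hθ⟩, hcirc⟩ := circlePoint_spec
    ((add_le_add (nearPoint_sq_le hxs) (nearPoint_sq_le hys)).trans hnear)
    (hfar.trans (add_le_add (le_farPoint_sq _ _) (le_farPoint_sq _ _)))
  rw [← hoff] at hθ hcirc
  have hdx := convex_mem (nearPoint_mem hxs) (farPoint_mem hxs) h0 h1
  have hdy := convex_mem (nearPoint_mem hys) (farPoint_mem hys) h0 h1
  have e1 := congrArg Prod.fst hθ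
  have e2 := congrArg Prod.snd hθ
  simp only at e1 e2
  rw [← e1, hlx, hhx, offsetLo, offsetHi] at hdx
  rw [← e2, hly, hhy, offsetLo, offsetHi] at hdy
  have hpl := D.place_within (R := s / 2) (r := s / 2 - D.ℓ / D.v) (dx := (offsetFL D).1)
    (dy := (offsetFL D).2) (by linarith) (by linarith) (by linarith) (by linarith)
    (by linarith) (by linarith) (by linarith) (by linarith)
  rw [hs] at hpl
  refine ⟨hpl.1, hpl.2, ?_⟩
  simpa [solveFL, BoxProblem.place] using hcirc

theorem solveFL_optimal (D : BoxProblem) {f t : ℝ × ℝ} {R : ℝ} (hℓ : 0 ≤ D.ℓ)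
    (h : D.Serves f t R D.ℓ) : (solveFL D).radius ≤ R := by
  obtain ⟨⟨w1, w2, w3, w4⟩, ⟨b1, b2, b3, b4⟩, hd⟩ := h
  suffices diameterFL D ≤ 2 * R by
    simp only [solveFL, BoxProblem.place]
    linarith
  simp only [diameterFL]
  have hx1 : offsetLo D.W.x1 D.B.x2 (D.ℓ / D.v) - 2 * R ≤ t.1 - f.1 := by
    rw [offsetLo]; linarith
  have hx2 : t.1 - f.1 ≤ offsetHi D.W.x2 D.B.x1 (D.ℓ / D.v) + 2 * R := by
    rw [offsetHi]; linarith
  have hy1 : offsetLo D.W.y1 D.B.y2 (D.ℓ / D.v) - 2 * R ≤ t.2 - f.2 := by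
    rw [offsetLo]; linarith
  have hy2 : t.2 - f.2 ≤ offsetHi D.W.y2 D.B.y1 (D.ℓ / D.v) + 2 * R := by
    rw [offsetHi]; linarith
  have near_le {l h d : ℝ} (h1 : l - 2 * R ≤ d) (h2 : d ≤ h + 2 * R) :
      max 0 (max l (-h) - 2 * R) ^ 2 ≤ d ^ 2 := by
    rw [← sub_sup_neg, sq_le_sq, abs_of_nonneg (le_max_left _ _)]
    exact max_le (abs_nonneg _) (max_le (h1.trans (le_abs_self _))
      ((neg_le_neg h2).trans (neg_le_abs _)))
  have le_far {l h d : ℝ} (h1 : l - 2 * R ≤ d) (h2 : d ≤ h + 2 * R) :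
      d ^ 2 ≤ (2 * R + max (-l) h) ^ 2 := by
    rw [← neg_sub_sup]
    exact sq_le_sq' (by linarith [le_max_left (-(l - 2 * R)) (h + 2 * R)])
      (h2.trans (le_max_right _ _))
  refine max_le (max_le (max_le (by linarith) (by linarith)) ?_) (max_le ?_ ?_)
  · rcases max_cases (D.B.x2 - D.B.x1) (D.B.y2 - D.B.y1) with h | h <;> linarith
  · rw [farThreshold_le_iff (add_max_neg_nonneg (hx1.trans hx2))
      (add_max_neg_nonneg (hy1.trans hy2)), ← hd]
    exact add_le_add (le_far hx1 hx2) (le_far hy1 hy2)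
  · rw [nearThreshold_le_iff hℓ, ← hd]
    exact add_le_add (near_le hx1 hx2) (near_le hy1 hy2)

/-! ### Two boxes and a turnpike of arbitrary length -/

/-- Half of the larger side of a box. -/
noncomputable def Box.halfSide (b : Box) : ℝ := max (b.x2 - b.x1) (b.y2 - b.y1) / 2

/-- The optimal travel time on the turnpike in the box problem with a turnpike of arbitrary length:
the clients in `B` walk `r = B.halfSide`, which is best because a turnpike with speed `v > 1` gains
more by being extended than the clients lose by a smaller `r`. -/
noncomputable def rideVL (D : BoxProblem) : ℝ :=
  -- the offset box is `[offsetLo - y, offsetHi + y]` for the sum `2 * g + y` of the two half sides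
  let g := D.B.halfSide
  let lx := offsetLo D.W.x1 D.B.x2 (-(2 * g))
  let hx := offsetHi D.W.x2 D.B.x1 (-(2 * g))
  let ly := offsetLo D.W.y1 D.B.y2 (-(2 * g))
  let hy := offsetHi D.W.y2 D.B.y1 (-(2 * g))
  max (max (growthThreshold (max lx (-hx)) (max ly (-hy)) D.v) (D.W.halfSide - g)) 0

/-- The shortest possible offset of a turnpike on which the clients may spend time `rideVL`. -/
noncomputable def offsetVL (D : BoxProblem) : ℝ × ℝ :=
  let y := rideVL D
  let g := D.B.halfSide
  (nearPoint (offsetLo D.W.x1 D.B.x2 (-(2 * g)) - y) (offsetHi D.W.x2 D.B.x1 (-(2 * g)) + y),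
    nearPoint (offsetLo D.W.y1 D.B.y2 (-(2 * g)) - y) (offsetHi D.W.y2 D.B.y1 (-(2 * g)) + y))

/-- The optimal solution of the box problem with a turnpike of arbitrary length. -/
noncomputable def solveVL (D : BoxProblem) : BoxSolution :=
  D.place (rideVL D + D.B.halfSide) D.B.halfSide (offsetVL D).1 (offsetVL D).2

theorem solveVL_sound (D : BoxProblem) (hv : 1 < D.v) :
    ∃ len, 0 ≤ len ∧ D.Serves (solveVL D).f (solveVL D).t (solveVL D).radius len := by
  obtain ⟨y, hy⟩ : ∃ y, y = rideVL D := ⟨_, rfl⟩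
  have hy' := hy.symm.le
  simp only [rideVL, max_le_iff] at hy'
  obtain ⟨⟨hgrow, hwg⟩, hy0⟩ := hy'
  obtain ⟨g, hg⟩ : ∃ g, g = D.B.halfSide := ⟨_, rfl⟩
  have hbx : D.B.x2 - D.B.x1 ≤ 2 * g := by
    rw [hg, Box.halfSide]; linarith [le_max_left (D.B.x2 - D.B.x1) (D.B.y2 - D.B.y1)]
  have hby : D.B.y2 - D.B.y1 ≤ 2 * g := by
    rw [hg, Box.halfSide]; linarith [le_max_right (D.B.x2 - D.B.x1) (D.B.y2 - D.B.y1)]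
  rw [← hg] at hgrow hwg
  rw [Box.halfSide] at hwg
  have hwx := le_max_left (D.W.x2 - D.W.x1) (D.W.y2 - D.W.y1)
  have hwy := le_max_right (D.W.x2 - D.W.x1) (D.W.y2 - D.W.y1)
  have hoff : offsetVL D = offsetVL D := rfl
  conv_rhs at hoff => simp only [offsetVL, ← hy, ← hg]
  obtain ⟨lx, hlx⟩ : ∃ l, l = offsetLo D.W.x1 D.B.x2 (-(2 * g)) := ⟨_, rfl⟩
  obtain ⟨hx, hhx⟩ : ∃ l, l = offsetHi D.W.x2 D.B.x1 (-(2 * g)) := ⟨_, rfl⟩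
  obtain ⟨ly, hly⟩ : ∃ l, l = offsetLo D.W.y1 D.B.y2 (-(2 * g)) := ⟨_, rfl⟩
  obtain ⟨hy2, hhy⟩ : ∃ l, l = offsetHi D.W.y2 D.B.y1 (-(2 * g)) := ⟨_, rfl⟩
  rw [← hlx, ← hhx, ← hly, ← hhy] at hgrow hoff
  have hxs : lx - y ≤ hx + y := by rw [hlx, hhx, offsetLo, offsetHi]; linarith
  have hys : ly - y ≤ hy2 + y := by rw [hly, hhy, offsetLo, offsetHi]; linarith
  rw [growthThreshold_le_iff hv hy0, ← sub_sup_neg, ← sub_sup_neg] at hgrow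
  have hnear := (add_le_add (nearPoint_sq_le hxs) (nearPoint_sq_le hys)).trans hgrow
  have hdx := nearPoint_mem hxs
  have hdy := nearPoint_mem hys
  have e1 := congrArg Prod.fst hoff
  have e2 := congrArg Prod.snd hoff
  simp only at e1 e2
  rw [← e1, ← e2] at hnear
  rw [← e1, hlx, hhx, offsetLo, offsetHi] at hdx
  rw [← e2, hly, hhy, offsetLo, offsetHi] at hdy
  have hpl := D.place_within (R := y + g) (r := g) (dx := (offsetVL D).1)
    (dy := (offsetVL D).2) (by linarith) (by linarith) (by linarith) (by linarith)
    (by linarith) (by linarith) (by linarith) (by linarith)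
  obtain ⟨q, hq⟩ : ∃ q, q = (offsetVL D).1 ^ 2 + (offsetVL D).2 ^ 2 := ⟨_, rfl⟩
  have hq0 : 0 ≤ q := hq ▸ by positivity
  have hlen : Real.sqrt (q / 2) / D.v ≤ y := by
    rw [div_le_iff₀ (by linarith), Real.sqrt_le_iff]
    refine ⟨mul_nonneg hy0 (by linarith), ?_⟩
    rw [← hq] at hnear
    linarith
  refine ⟨Real.sqrt (q / 2), Real.sqrt_nonneg _, ?_, ?_, ?_⟩
  · rw [hy, hg] at hpl
    exact hpl.1
  · have hr : g ≤ y + g - Real.sqrt (q / 2) / D.v := by linarith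
    have hR : (solveVL D).radius = y + g := by rw [hy, hg]; rfl
    obtain ⟨h1, h2, h3, h4⟩ := hpl.2
    rw [hR]
    rw [hy, hg] at h1 h2 h3 h4 hr ⊢
    exact ⟨by linarith! [h1], by linarith! [h2], by linarith! [h3], by linarith! [h4]⟩
  · rw [Real.sq_sqrt (by linarith)]
    simp only [solveVL, BoxProblem.place]
    rw [hq]
    ring

theorem solveVL_optimal (D : BoxProblem) {f t : ℝ × ℝ} {R len : ℝ} (hv : 1 < D.v)
    (hlen : 0 ≤ len) (h : D.Serves f t R len) : (solveVL D).radius ≤ R := by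
  obtain ⟨⟨w1, w2, w3, w4⟩, ⟨b1, b2, b3, b4⟩, hd⟩ := h
  obtain ⟨c, hc⟩ : ∃ c, c = len / D.v := ⟨_, rfl⟩
  have hc0 : 0 ≤ c := hc ▸ div_nonneg hlen (by linarith)
  have hcv : len = D.v * c := by rw [hc]; field_simp
  rw [← hc] at b1 b2 b3 b4
  obtain ⟨g, hg⟩ : ∃ g, g = D.B.halfSide := ⟨_, rfl⟩
  have hgR : g ≤ R - c := by
    rw [hg, Box.halfSide]
    rcases max_cases (D.B.x2 - D.B.x1) (D.B.y2 - D.B.y1) with h | h <;> linarith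
  suffices rideVL D ≤ R - g by
    simp only [solveVL, BoxProblem.place]
    linarith
  simp only [rideVL]
  rw [← hg]
  -- riding longer by the time `z` shrinks the offset box by `z` on each side, but lengthens the
  -- turnpike by `v * z`
  have hx1 : offsetLo D.W.x1 D.B.x2 (-(2 * g)) - 2 * (R - g) + c ≤ t.1 - f.1 := by
    rw [offsetLo]; linarith
  have hx2 : t.1 - f.1 ≤ offsetHi D.W.x2 D.B.x1 (-(2 * g)) + 2 * (R - g) - c := by
    rw [offsetHi]; linarith
  have hy1 : offsetLo D.W.y1 D.B.y2 (-(2 * g)) - 2 * (R - g) + c ≤ t.2 - f.2 := by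
    rw [offsetLo]; linarith
  have hy2 : t.2 - f.2 ≤ offsetHi D.W.y2 D.B.y1 (-(2 * g)) + 2 * (R - g) - c := by
    rw [offsetHi]; linarith
  obtain ⟨z, hz⟩ : ∃ z, z = R - g - c := ⟨_, rfl⟩
  have hz0 : 0 ≤ z := by linarith
  have near_le {l h d : ℝ} (h1 : l - 2 * (R - g) + c ≤ d) (h2 : d ≤ h + 2 * (R - g) - c) :
      max 0 (max l (-h) - (R - g)) ^ 2 ≤ (|d| + z) ^ 2 := by
    refine pow_le_pow_left₀ (le_max_left _ _) ?_ 2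
    rw [← sub_sup_neg]
    refine max_le (by positivity) (max_le ?_ ?_)
    · linarith [le_abs_self d]
    · linarith [neg_le_abs d]
  refine max_le (max_le ?_ ?_) (by linarith)
  · rw [growthThreshold_le_iff hv (by linarith)]
    refine (add_le_add (near_le hx1 hx2) (near_le hy1 hy2)).trans ?_
    have hd' : |t.1 - f.1| ^ 2 + |t.2 - f.2| ^ 2 = 2 * (D.v * c) ^ 2 := by
      rw [sq_abs, sq_abs, hd, hcv]
    have hsum : |t.1 - f.1| + |t.2 - f.2| ≤ 2 * (D.v * c) := by
      refine le_of_abs_le (abs_le_of_sq_le_sq ?_ (by positivity))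
      nlinarith [sq_nonneg (|t.1 - f.1| - |t.2 - f.2|)]
    have h1 : (|t.1 - f.1| + z) ^ 2 + (|t.2 - f.2| + z) ^ 2 ≤ 2 * (D.v * c + z) ^ 2 := by
      nlinarith [mul_le_mul_of_nonneg_left hsum hz0]
    have h2 : (D.v * c + z) ^ 2 ≤ (D.v * (R - g)) ^ 2 := by
      refine pow_le_pow_left₀ (by positivity) ?_ 2
      have : z ≤ D.v * z := le_mul_of_one_le_left hz0 hv.le
      have e : D.v * (R - g) = D.v * c + D.v * z := by rw [hz]; ring
      linarith
    rw [mul_pow] at h2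
    linarith
  · rw [Box.halfSide]
    rcases max_cases (D.W.x2 - D.W.x1) (D.W.y2 - D.W.y1) with h | h <;> linarith

/-! ### The solvers are given by expressions -/

section

open RealRAM Expressible

variable {D : State → BoxProblem}

theorem ExpressibleProblem.place (hD : ExpressibleProblem D) {R r dx dy : State → ℝ}
    (hR : Expressible R) (hr : Expressible r) (hx : Expressible dx) (hy : Expressible dy) :
    ExpressibleSolution fun σ => (D σ).place (R σ) (r σ) (dx σ) (dy σ) where
  radius := hR
  fx := (hD.wx2.sub hR).max ((hD.bx2.sub hr).sub hx)
  fy := (hD.wy2.sub hR).max ((hD.by2.sub hr).sub hy)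
  tx := ((hD.wx2.sub hR).max ((hD.bx2.sub hr).sub hx)).add hx
  ty := ((hD.wy2.sub hR).max ((hD.by2.sub hr).sub hy)).add hy

variable {f g h k l : State → ℝ}

theorem expressible_nearPoint (hf : Expressible f) (hg : Expressible g) :
    Expressible fun σ => nearPoint (f σ) (g σ) := hf.max (zero.min hg)

theorem expressible_farPoint (hf : Expressible f) (hg : Expressible g) :
    Expressible fun σ => farPoint (f σ) (g σ) := (hf.add hg).ite_pos hg hf

theorem expressible_farThreshold (hf : Expressible f) (hg : Expressible g) (hh : Expressible h) :
    Expressible fun σ => farThreshold (f σ) (g σ) (h σ) :=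
  ((hf.add hg).neg.add ((((ofNat 4).mul hh.sq).sub (hf.sub hg).sq).sqrt)).div (ofNat 2)

theorem expressible_nearThreshold (hf : Expressible f) (hg : Expressible g) (hh : Expressible h) :
    Expressible fun σ => nearThreshold (f σ) (g σ) (h σ) := by
  have hm := (hf.sub hg).abs.min ((ofNat 2).sqrt.mul hh)
  exact (hf.max hg).sub ((hm.add (((ofNat 4).mul hh.sq).sub hm.sq).sqrt).div (ofNat 2))

theorem expressible_growthThreshold (hf : Expressible f) (hg : Expressible g)
    (hh : Expressible h) : Expressible fun σ => growthThreshold (f σ) (g σ) (h σ) := by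
  have ha := (hf.max hg).max zero
  have hb := (hf.min hg).max (ha.div (one.add ((ofNat 2).sqrt.mul hh)))
  have hv := (ofNat 2).mul (hh.sq.sub one)
  exact ((ha.add hb).neg.add ((ha.add hb).sq.add (hv.mul (ha.sq.add hb.sq))).sqrt).div hv

theorem expressible_circlePoint (hf : Expressible f) (hg : Expressible g) (hh : Expressible h)
    (hk : Expressible k) (hl : Expressible l) :
    (Expressible fun σ => (circlePoint (f σ) (g σ) (h σ) (k σ) (l σ)).1) ∧
      Expressible fun σ => (circlePoint (f σ) (g σ) (h σ) (k σ) (l σ)).2 := by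
  have hA := (hh.sub hf).sq.add (hk.sub hg).sq
  have hB := (hf.mul (hh.sub hf)).add (hg.mul (hk.sub hg))
  have hC := (hf.sq.add hg.sq).sub ((ofNat 2).mul hl.sq)
  have hθ := (hB.neg.add (hB.sq.sub (hA.mul hC)).sqrt).div hA
  exact ⟨hf.add (hθ.mul (hh.sub hf)), hg.add (hθ.mul (hk.sub hg))⟩

theorem expressible_offsetLo (hf : Expressible f) (hg : Expressible g) (hh : Expressible h) :
    Expressible fun σ => offsetLo (f σ) (g σ) (h σ) := (hg.sub hf).add hh

theorem expressible_offsetHi (hf : Expressible f) (hg : Expressible g) (hh : Expressible h) :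
    Expressible fun σ => offsetHi (f σ) (g σ) (h σ) := (hg.sub hf).sub hh

theorem ExpressibleProblem.solveFL (hD : ExpressibleProblem D) :
    ExpressibleSolution fun σ => solveFL (D σ) := by
  have hc := hD.ℓ.div hD.v
  have hlx := expressible_offsetLo hD.wx1 hD.bx2 hc
  have hhx := expressible_offsetHi hD.wx2 hD.bx1 hc
  have hly := expressible_offsetLo hD.wy1 hD.by2 hc
  have hhy := expressible_offsetHi hD.wy2 hD.by1 hc
  have hs : Expressible fun σ => diameterFL (D σ) :=
    (((hD.wx2.sub hD.wx1).max (hD.wy2.sub hD.wy1)).max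
      (((hD.bx2.sub hD.bx1).max (hD.by2.sub hD.by1)).add ((ofNat 2).mul hc))).max
      ((expressible_farThreshold (hlx.neg.max hhx) (hly.neg.max hhy) hD.ℓ).max
        (expressible_nearThreshold (hlx.max hhx.neg) (hly.max hhy.neg) hD.ℓ))
  have hoff := expressible_circlePoint
    (expressible_nearPoint (hlx.sub hs) (hhx.add hs)) (expressible_nearPoint (hly.sub hs) (hhy.add hs))
    (expressible_farPoint (hlx.sub hs) (hhx.add hs)) (expressible_farPoint (hly.sub hs) (hhy.add hs))
    hD.ℓ
  have hR := hs.div (ofNat 2)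
  exact hD.place hR (hR.sub hc) hoff.1 hoff.2

theorem ExpressibleProblem.solveVL (hD : ExpressibleProblem D) :
    ExpressibleSolution fun σ => solveVL (D σ) := by
  have hg : Expressible fun σ => (D σ).B.halfSide :=
    ((hD.bx2.sub hD.bx1).max (hD.by2.sub hD.by1)).div (ofNat 2)
  have hw : Expressible fun σ => (D σ).W.halfSide :=
    ((hD.wx2.sub hD.wx1).max (hD.wy2.sub hD.wy1)).div (ofNat 2)
  have hc := ((ofNat 2).mul hg).neg
  have hlx := expressible_offsetLo hD.wx1 hD.bx2 hc
  have hhx := expressible_offsetHi hD.wx2 hD.bx1 hc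
  have hly := expressible_offsetLo hD.wy1 hD.by2 hc
  have hhy := expressible_offsetHi hD.wy2 hD.by1 hc
  have hy : Expressible fun σ => rideVL (D σ) :=
    ((expressible_growthThreshold (hlx.max hhx.neg) (hly.max hhy.neg) hD.v).max
      (hw.sub hg)).max zero
  exact hD.place (hy.add hg) hg (expressible_nearPoint (hlx.sub hy) (hhx.add hy))
    (expressible_nearPoint (hly.sub hy) (hhy.add hy))

end

theorem isSolver_solveFL : IsSolver (fun ℓ len => len = ℓ) solveFL where
  sound D _ hℓ := ⟨D.ℓ, hℓ, rfl, solveFL_sound D hℓ⟩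
  optimal D _ _ _ _ _ hℓ _ hlen h := solveFL_optimal D hℓ (hlen ▸ h)
  expressible _ hD := hD.solveFL

theorem isSolver_solveVL : IsSolver (fun _ _ => True) solveVL where
  sound D hv _ := by
    obtain ⟨len, h0, h⟩ := solveVL_sound D hv
    exact ⟨len, h0, trivial, h⟩
  optimal D _ _ _ _ hv _ h0 _ h := solveVL_optimal D hv h0 h
  expressible _ hD := hD.solveVL

end Turnpike

/-! ### Bounding boxes of clients -/

namespace Turnpike

/-- The point `p` lies in the box. -/
def Box.Mem (b : Box) (p : ℝ × ℝ) : Prop :=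
  (b.x1 ≤ p.1 ∧ p.1 ≤ b.x2) ∧ b.y1 ≤ p.2 ∧ p.2 ≤ b.y2

/-- The point `p` has `L∞` distance at most `R` from `f`. -/
def InSquare (f : ℝ × ℝ) (R : ℝ) (p : ℝ × ℝ) : Prop := |p.1 - f.1| ≤ R ∧ |p.2 - f.2| ≤ R

/-- The bounding box of the union of two boxes. -/
noncomputable def Box.join (b c : Box) : Box where
  x1 := min b.x1 c.x1
  x2 := max b.x2 c.x2
  y1 := min b.y1 c.y1
  y2 := max b.y2 c.y2

/-- The box that consists of one point. -/
def Box.point (p : ℝ × ℝ) : Box := ⟨p.1, p.1, p.2, p.2⟩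

/-- The box `b` with opposite sides exchanged. It serves as the neutral element from which the
bounding box of some of the points in `b` is accumulated. -/
def Box.flip (b : Box) : Box := ⟨b.x2, b.x1, b.y2, b.y1⟩

open Classical in
/-- The bounding box of those points among `P 0, …, P (k - 1)` that satisfy `C`, accumulated from
the box `b`. -/
noncomputable def scanBox (b : Box) (C : ℝ × ℝ → Prop) (P : ℕ → ℝ × ℝ) : ℕ → Box
  | 0 => b
  | k + 1 => if C (P k) then (scanBox b C P k).join (Box.point (P k)) else scanBox b C P k

theorem Box.Within.inSquare {b : Box} {f p : ℝ × ℝ} {R : ℝ} (h : b.Within f R) (hp : b.Mem p) :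
    InSquare f R p := by
  obtain ⟨h1, h2, h3, h4⟩ := h
  obtain ⟨⟨p1, p2⟩, p3, p4⟩ := hp
  constructor <;> rw [abs_le] <;> constructor <;> linarith

theorem Box.Mem.join_left {b c : Box} {p : ℝ × ℝ} (h : b.Mem p) : (b.join c).Mem p :=
  ⟨⟨(min_le_left _ _).trans h.1.1, h.1.2.trans (le_max_left _ _)⟩,
    (min_le_left _ _).trans h.2.1, h.2.2.trans (le_max_left _ _)⟩

theorem Box.Mem.join_right {b c : Box} {p : ℝ × ℝ} (h : c.Mem p) : (b.join c).Mem p :=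
  ⟨⟨(min_le_right _ _).trans h.1.1, h.1.2.trans (le_max_right _ _)⟩,
    (min_le_right _ _).trans h.2.1, h.2.2.trans (le_max_right _ _)⟩

theorem Box.mem_point (p : ℝ × ℝ) : (Box.point p).Mem p := ⟨⟨le_rfl, le_rfl⟩, le_rfl, le_rfl⟩

theorem InSquare.within_point {f p : ℝ × ℝ} {R : ℝ} (h : InSquare f R p) :
    (Box.point p).Within f R := by
  obtain ⟨h1, h2⟩ := h
  rw [abs_le] at h1 h2
  refine ⟨?_, ?_, ?_, ?_⟩ <;> simp only [Box.point] <;> linarith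

theorem Box.Within.join {b c : Box} {f : ℝ × ℝ} {R : ℝ} (hb : b.Within f R) (hc : c.Within f R) :
    (b.join c).Within f R := by
  obtain ⟨b1, b2, b3, b4⟩ := hb
  obtain ⟨c1, c2, c3, c4⟩ := hc
  refine ⟨?_, ?_, ?_, ?_⟩ <;> simp only [Box.join]
  · rcases max_cases b.x2 c.x2 with h | h <;> linarith
  · rcases min_cases b.x1 c.x1 with h | h <;> linarith
  · rcases max_cases b.y2 c.y2 with h | h <;> linarith
  · rcases min_cases b.y1 c.y1 with h | h <;> linarith

theorem scanBox_mem {b : Box} {C : ℝ × ℝ → Prop} {P : ℕ → ℝ × ℝ} {m k : ℕ} (hk : k < m)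
    (hC : C (P k)) : (scanBox b C P m).Mem (P k) := by
  induction m with
  | zero => omega
  | succ m ih =>
    rw [scanBox]
    rcases Nat.lt_succ_iff_lt_or_eq.mp hk with h | rfl
    · split_ifs
      · exact (ih h).join_left
      · exact ih h
    · rw [if_pos hC]
      exact (Box.mem_point _).join_right

theorem Box.join_eq_right {b c : Box} (h1 : c.x1 ≤ b.x1) (h2 : b.x2 ≤ c.x2) (h3 : c.y1 ≤ b.y1)
    (h4 : b.y2 ≤ c.y2) : b.join c = c := by
  cases c
  simp_all [Box.join]

theorem Box.join_comm (b c : Box) : b.join c = c.join b := by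
  simp [Box.join, min_comm, max_comm]

theorem Box.join_assoc (b c d : Box) : (b.join c).join d = b.join (c.join d) := by
  simp [Box.join, min_assoc, max_assoc]

theorem Box.Mem.flip_join {b : Box} {p : ℝ × ℝ} (h : b.Mem p) :
    b.flip.join (Box.point p) = Box.point p :=
  Box.join_eq_right h.1.2 h.1.1 h.2.2 h.2.1

/-- The accumulated box is the initial one if no point was found. Otherwise the initial box is
absorbed, and the accumulated box fits into every square that contains the points. -/
theorem scanBox_flip_cases {E : Box} {C : ℝ × ℝ → Prop} {P : ℕ → ℝ × ℝ} {f : ℝ × ℝ} {R : ℝ} {m : ℕ}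
    (hE : ∀ k < m, E.Mem (P k)) (h : ∀ k < m, C (P k) → InSquare f R (P k)) :
    ((∀ k < m, ¬ C (P k)) ∧ scanBox E.flip C P m = E.flip) ∨
      ((scanBox E.flip C P m).Within f R ∧
        E.flip.join (scanBox E.flip C P m) = scanBox E.flip C P m) := by
  induction m with
  | zero => exact .inl ⟨fun k hk => by omega, rfl⟩
  | succ m ih =>
    have ih := ih (fun k hk => hE k (by omega)) fun k hk => h k (by omega)
    rw [scanBox]
    split_ifs with hC
    · have hp := (h m (by omega) hC).within_point
      right
      rcases ih with ⟨-, ih⟩ | ⟨ih, ih'⟩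
      · rw [ih, (hE m (by omega)).flip_join]
        exact ⟨hp, (hE m (by omega)).flip_join⟩
      · exact ⟨ih.join hp, by rw [← Box.join_assoc, ih']⟩
    · rcases ih with ⟨ih, ih'⟩ | ih
      · left
        refine ⟨fun k hk => ?_, ih'⟩
        rcases Nat.lt_succ_iff_lt_or_eq.mp hk with h | rfl
        · exact ih k h
        · exact hC
      · exact .inr ih

/-- The bounding box of `P 0, …, P (n - 1)`, for `n ≥ 1`. -/
noncomputable def extent (P : ℕ → ℝ × ℝ) (n : ℕ) : Box :=
  scanBox (Box.point (P 0)) (fun _ => True) P n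

theorem extent_mem {P : ℕ → ℝ × ℝ} {n k : ℕ} (hk : k < n) : (extent P n).Mem (P k) :=
  scanBox_mem hk trivial

theorem extent_attained (P : ℕ → ℝ × ℝ) {n : ℕ} (hn : 0 < n) :
    (∃ k < n, (extent P n).x1 = (P k).1) ∧ (∃ k < n, (extent P n).x2 = (P k).1) ∧
      (∃ k < n, (extent P n).y1 = (P k).2) ∧ ∃ k < n, (extent P n).y2 = (P k).2 := by
  have key : ∀ m, (∃ k < m + 1, (extent P m).x1 = (P k).1 ∧ (k < m ∨ k = 0)) ∧
      (∃ k < m + 1, (extent P m).x2 = (P k).1 ∧ (k < m ∨ k = 0)) ∧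
      (∃ k < m + 1, (extent P m).y1 = (P k).2 ∧ (k < m ∨ k = 0)) ∧
      ∃ k < m + 1, (extent P m).y2 = (P k).2 ∧ (k < m ∨ k = 0) := by
    intro m
    induction m with
    | zero => exact ⟨⟨0, by simp, rfl, .inr rfl⟩, ⟨0, by simp, rfl, .inr rfl⟩,
        ⟨0, by simp, rfl, .inr rfl⟩, ⟨0, by simp, rfl, .inr rfl⟩⟩
    | succ m ih =>
      obtain ⟨⟨a, ha, ha', -⟩, ⟨b, hb, hb', -⟩, ⟨c, hc, hc', -⟩, ⟨d, hd, hd', -⟩⟩ := ih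
      have e : extent P (m + 1) = (extent P m).join (Box.point (P m)) := by
        simp [extent, scanBox]
      rw [e]
      simp only [Box.join, Box.point]
      refine ⟨?_, ?_, ?_, ?_⟩
      · rcases min_choice (extent P m).x1 (P m).1 with h | h <;> rw [h]
        · exact ⟨a, by omega, ha', by omega⟩
        · exact ⟨m, by omega, rfl, by omega⟩
      · rcases max_choice (extent P m).x2 (P m).1 with h | h <;> rw [h]
        · exact ⟨b, by omega, hb', by omega⟩
        · exact ⟨m, by omega, rfl, by omega⟩
      · rcases min_choice (extent P m).y1 (P m).2 with h | h <;> rw [h]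
        · exact ⟨c, by omega, hc', by omega⟩
        · exact ⟨m, by omega, rfl, by omega⟩
      · rcases max_choice (extent P m).y2 (P m).2 with h | h <;> rw [h]
        · exact ⟨d, by omega, hd', by omega⟩
        · exact ⟨m, by omega, rfl, by omega⟩
  obtain ⟨⟨a, -, ha', ha⟩, ⟨b, -, hb', hb⟩, ⟨c, -, hc', hc⟩, ⟨d, -, hd', hd⟩⟩ := key n
  exact ⟨⟨a, by omega, ha'⟩, ⟨b, by omega, hb'⟩, ⟨c, by omega, hc'⟩, ⟨d, by omega, hd'⟩⟩

theorem extent_within {P : ℕ → ℝ × ℝ} {n : ℕ} (hn : 0 < n) {f : ℝ × ℝ} {R : ℝ}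
    (h : ∀ k < n, InSquare f R (P k)) : (extent P n).Within f R := by
  obtain ⟨⟨a, ha, ea⟩, ⟨b, hb, eb⟩, ⟨c, hc, ec⟩, ⟨d, hd, ed⟩⟩ := extent_attained P hn
  have h1 := abs_le.mp (h a ha).1
  have h2 := abs_le.mp (h b hb).1
  have h3 := abs_le.mp (h c hc).2
  have h4 := abs_le.mp (h d hd).2
  exact ⟨by linarith, by linarith, by linarith, by linarith⟩

/-! ### The candidate partitions of the clients -/

/-- The bounding box of the clients to the right of client `i`. -/
noncomputable def rightBox (P : ℕ → ℝ × ℝ) (n i : ℕ) : Box :=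
  scanBox (extent P n).flip (fun p => (P i).1 < p.1) P n

/-- The bounding box of the clients above client `j`. -/
noncomputable def upperBox (P : ℕ → ℝ × ℝ) (n j : ℕ) : Box :=
  scanBox (extent P n).flip (fun p => (P j).2 < p.2) P n

/-- The box in the lower left corner of the bounding box of the clients that is cut off by the
abscissa of client `i` and the ordinate of client `j`. -/
noncomputable def cornerBox (P : ℕ → ℝ × ℝ) (n i j : ℕ) : Box :=
  ⟨(extent P n).x1, (P i).1, (extent P n).y1, (P j).2⟩

/-- The bounding box of the clients that do not belong to the corner. -/
noncomputable def restBox (P : ℕ → ℝ × ℝ) (n i j : ℕ) : Box :=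
  (rightBox P n i).join (upperBox P n j)

theorem cornerBox_or_restBox {P : ℕ → ℝ × ℝ} {n i j k : ℕ} (hk : k < n) :
    (cornerBox P n i j).Mem (P k) ∨ (restBox P n i j).Mem (P k) := by
  by_cases h1 : (P i).1 < (P k).1
  · exact .inr (Box.Mem.join_left (scanBox_mem hk h1))
  by_cases h2 : (P j).2 < (P k).2
  · exact .inr (Box.Mem.join_right (scanBox_mem hk h2))
  have h := extent_mem (P := P) hk
  exact .inl ⟨⟨h.1.1, not_lt.mp h1⟩, h.2.1, not_lt.mp h2⟩

theorem exists_argmax {n : ℕ} (S : ℕ → Prop) (g : ℕ → ℝ) {m : ℕ} (hm : m < n) (hS : S m) :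
    ∃ i < n, S i ∧ ∀ k < n, S k → g k ≤ g i := by
  classical
  obtain ⟨i, hi, hmax⟩ := Finset.exists_max_image ((Finset.range n).filter S) g
    ⟨m, by simp [hm, hS]⟩
  simp only [Finset.mem_filter, Finset.mem_range] at hi hmax
  exact ⟨i, hi.1, hi.2, fun k hk h => hmax k ⟨hk, h⟩⟩

/-- If the square around `a` contains a leftmost and a lowest client, then its clients have a corner
as their bounding box. -/
theorem exists_corner {P : ℕ → ℝ × ℝ} {n : ℕ} {a b : ℝ × ℝ} {ra rb : ℝ} {x y : ℕ} (hx : x < n)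
    (hxa : InSquare a ra (P x)) (hxmin : ∀ k < n, (P x).1 ≤ (P k).1) (hy : y < n)
    (hya : InSquare a ra (P y)) (hymin : ∀ k < n, (P y).2 ≤ (P k).2)
    (hcov : ∀ k < n, InSquare a ra (P k) ∨ InSquare b rb (P k)) :
    (∀ k < n, InSquare a ra (P k)) ∨ ∃ i < n, ∃ j < n,
      (cornerBox P n i j).Within a ra ∧ (restBox P n i j).Within b rb := by
  obtain ⟨i, hi, hia, himax⟩ := exists_argmax (fun k => InSquare a ra (P k)) (fun k => (P k).1)
    hx hxa
  obtain ⟨j, hj, hja, hjmax⟩ := exists_argmax (fun k => InSquare a ra (P k)) (fun k => (P k).2)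
    hx hxa
  obtain ⟨⟨x', hx', ex⟩, -, ⟨y', hy', ey⟩, -⟩ := extent_attained P (Nat.zero_lt_of_lt hx)
  have ex1 : (extent P n).x1 = (P x).1 :=
    le_antisymm (extent_mem hx).1.1 (ex ▸ hxmin x' hx')
  have ey1 : (extent P n).y1 = (P y).2 :=
    le_antisymm (extent_mem hy).2.1 (ey ▸ hymin y' hy')
  have hcorner : (cornerBox P n i j).Within a ra := by
    have h1 := abs_le.mp hxa.1
    have h2 := abs_le.mp hya.2
    have h3 := abs_le.mp hia.1
    have h4 := abs_le.mp hja.2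
    refine ⟨?_, ?_, ?_, ?_⟩ <;> simp only [cornerBox, ex1, ey1] <;> linarith
  have hE : ∀ k < n, (extent P n).Mem (P k) := fun k hk => extent_mem hk
  have hr := scanBox_flip_cases (C := fun p => (P i).1 < p.1) hE (f := b) (R := rb)
    fun k hk h => (hcov k hk).resolve_left fun h' => absurd (himax k hk h') (not_le.mpr h)
  have hu := scanBox_flip_cases (C := fun p => (P j).2 < p.2) hE (f := b) (R := rb)
    fun k hk h => (hcov k hk).resolve_left fun h' => absurd (hjmax k hk h') (not_le.mpr h)
  rcases hr with ⟨hr, hr'⟩ | ⟨hr, hr'⟩ <;> rcases hu with ⟨hu, hu'⟩ | ⟨hu, hu'⟩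
  · left
    intro k hk
    exact hcorner.inSquare
      ⟨⟨(hE k hk).1.1, not_lt.mp (hr k hk)⟩, (hE k hk).2.1, not_lt.mp (hu k hk)⟩
  · refine .inr ⟨i, hi, j, hj, hcorner, ?_⟩
    rw [restBox, rightBox, hr', upperBox, hu']
    exact hu
  · refine .inr ⟨i, hi, j, hj, hcorner, ?_⟩
    rw [restBox, upperBox, hu', Box.join_comm, rightBox, hr']
    exact hr
  · exact .inr ⟨i, hi, j, hj, hcorner, hr.join hu⟩

/-! ### Rotated and reflected coordinates -/

/-- The coordinates `x + y` and `x - y`, multiplied by `s₁` and `s₂`. For signs `s₁` and `s₂`, the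
`L₁` distance becomes the `L∞` distance and the Euclidean distance is multiplied by `√2`. -/
def orient (s₁ s₂ : ℚ) (p : ℝ × ℝ) : ℝ × ℝ := (s₁ * (p.1 + p.2), s₂ * (p.1 - p.2))

/-- The inverse of `orient s₁ s₂`, for signs `s₁` and `s₂`. -/
noncomputable def unorient (s₁ s₂ : ℚ) (q : ℝ × ℝ) : ℝ × ℝ :=
  ((s₁ * q.1 + s₂ * q.2) / 2, (s₁ * q.1 - s₂ * q.2) / 2)

/-- `s` is a sign. -/
def IsSign (s : ℚ) : Prop := s = 1 ∨ s = -1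

theorem orient_unorient {s₁ s₂ : ℚ} (h₁ : IsSign s₁) (h₂ : IsSign s₂) (q : ℝ × ℝ) :
    orient s₁ s₂ (unorient s₁ s₂ q) = q := by
  rcases h₁ with rfl | rfl <;> rcases h₂ with rfl | rfl <;> ext <;>
    simp only [orient, unorient] <;> push_cast <;> ring

theorem l1Dist_le_iff (p q : ℝ × ℝ) (R : ℝ) :
    l1Dist p q ≤ R ↔ |(p.1 + p.2) - (q.1 + q.2)| ≤ R ∧ |(p.1 - p.2) - (q.1 - q.2)| ≤ R := by
  unfold l1Dist
  constructor
  · intro h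
    constructor <;> rw [abs_le] <;> constructor <;>
      linarith [neg_abs_le (p.1 - q.1), neg_abs_le (p.2 - q.2), le_abs_self (p.1 - q.1),
        le_abs_self (p.2 - q.2)]
  · rintro ⟨h1, h2⟩
    rw [abs_le] at h1 h2
    rcases abs_cases (p.1 - q.1) with h | h <;> rcases abs_cases (p.2 - q.2) with h' | h' <;>
      linarith

theorem IsSign.abs_sub {s : ℚ} (hs : IsSign s) (a b : ℝ) : |s * a - s * b| = |a - b| := by
  rcases hs with rfl | rfl
  · simp
  · rw [← abs_neg]
    congr 1
    push_cast
    ring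

theorem inSquare_orient {s₁ s₂ : ℚ} (h₁ : IsSign s₁) (h₂ : IsSign s₂) {f p : ℝ × ℝ} {R : ℝ} :
    InSquare (orient s₁ s₂ f) R (orient s₁ s₂ p) ↔ l1Dist p f ≤ R := by
  rw [l1Dist_le_iff]
  simp only [InSquare, orient, h₁.abs_sub, h₂.abs_sub]

theorem orient_sq_add_sq {s₁ s₂ : ℚ} (h₁ : IsSign s₁) (h₂ : IsSign s₂) (f t : ℝ × ℝ) :
    ((orient s₁ s₂ t).1 - (orient s₁ s₂ f).1) ^ 2 + ((orient s₁ s₂ t).2 - (orient s₁ s₂ f).2) ^ 2 =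
      2 * l2Dist t f ^ 2 := by
  rw [l2Dist, Real.sq_sqrt (by positivity)]
  rcases h₁ with rfl | rfl <;> rcases h₂ with rfl | rfl <;> simp only [orient] <;> push_cast <;> ring

/-- Two squares of which none contains both a leftmost or rightmost and a lowest or highest client
are such that one of them spans all abscissas and the other all ordinates. So the larger square alone
is large enough, unless the clients can be partitioned into a corner and the rest. -/
theorem exists_partition {p : ℕ → ℝ × ℝ} {n : ℕ} (hn : 0 < n) {a b : ℝ × ℝ} {ra rb R : ℝ}
    (ha : ra ≤ R) (hb : rb ≤ R) (hcov : ∀ k < n, l1Dist (p k) a ≤ ra ∨ l1Dist (p k) b ≤ rb) :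
    (extent (fun k => orient 1 1 (p k)) n).halfSide ≤ R ∨
    ∃ s₁ s₂, IsSign s₁ ∧ IsSign s₂ ∧ ∃ i < n, ∃ j < n,
      ((cornerBox (fun k => orient s₁ s₂ (p k)) n i j).Within (orient s₁ s₂ a) ra ∧
        (restBox (fun k => orient s₁ s₂ (p k)) n i j).Within (orient s₁ s₂ b) rb) ∨
      ((cornerBox (fun k => orient s₁ s₂ (p k)) n i j).Within (orient s₁ s₂ b) rb ∧
        (restBox (fun k => orient s₁ s₂ (p k)) n i j).Within (orient s₁ s₂ a) ra) := by
  have hone : IsSign 1 := .inl rfl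
  have hneg : IsSign (-1) := .inr rfl
  obtain ⟨P, hP⟩ : ∃ P : ℕ → ℝ × ℝ, P = fun k => orient 1 1 (p k) := ⟨_, rfl⟩
  rw [← hP]
  have hP1 : ∀ k, (P k).1 = (p k).1 + (p k).2 := fun k => by simp [hP, orient]
  have hP2 : ∀ k, (P k).2 = (p k).1 - (p k).2 := fun k => by simp [hP, orient]
  have hsq : ∀ k f r, l1Dist (p k) f ≤ r ↔ InSquare (orient 1 1 f) r (P k) := fun k f r => by
    rw [hP, inSquare_orient hone hone]
  obtain ⟨⟨x₁, hx₁, ex₁⟩, ⟨x₂, hx₂, ex₂⟩, ⟨y₁, hy₁, ey₁⟩, ⟨y₂, hy₂, ey₂⟩⟩ := extent_attained P hn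
  have single : ∀ c r, r ≤ R → (∀ k < n, l1Dist (p k) c ≤ r) → (extent P n).halfSide ≤ R := by
    intro c r hr h
    obtain ⟨h1, h2, h3, h4⟩ := extent_within hn fun k hk => (hsq k c r).mp (h k hk)
    rw [Box.halfSide]
    rcases max_cases ((extent P n).x2 - (extent P n).x1) ((extent P n).y2 - (extent P n).y1)
      with h | h <;> linarith
  -- an extreme abscissa and an extreme ordinate in the same square
  have corner : ∀ c d rc rd, rc ≤ R → (∀ k < n, l1Dist (p k) c ≤ rc ∨ l1Dist (p k) d ≤ rd) →
      ∀ x y, (x = x₁ ∨ x = x₂) → (y = y₁ ∨ y = y₂) → l1Dist (p x) c ≤ rc → l1Dist (p y) c ≤ rc →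
      (extent P n).halfSide ≤ R ∨ ∃ s₁ s₂, IsSign s₁ ∧ IsSign s₂ ∧ ∃ i < n, ∃ j < n,
        (cornerBox (fun k => orient s₁ s₂ (p k)) n i j).Within (orient s₁ s₂ c) rc ∧
        (restBox (fun k => orient s₁ s₂ (p k)) n i j).Within (orient s₁ s₂ d) rd := by
    intro c d rc rd hrc hcov x y hx hy hxc hyc
    have hx' : x < n := by rcases hx with rfl | rfl <;> assumption
    have hy' : y < n := by rcases hy with rfl | rfl <;> assumption
    have hsx : ∃ s₁ : ℚ, IsSign s₁ ∧ ∀ k < n, (s₁ : ℝ) * ((p x).1 + (p x).2) ≤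
        s₁ * ((p k).1 + (p k).2) := by
      rcases hx with rfl | rfl
      · refine ⟨1, hone, fun k hk => ?_⟩
        have := (extent_mem (P := P) hk).1.1
        rw [ex₁, hP1, hP1] at this
        push_cast
        linarith
      · refine ⟨-1, hneg, fun k hk => ?_⟩
        have := (extent_mem (P := P) hk).1.2
        rw [ex₂, hP1, hP1] at this
        push_cast
        linarith
    have hsy : ∃ s₂ : ℚ, IsSign s₂ ∧ ∀ k < n, (s₂ : ℝ) * ((p y).1 - (p y).2) ≤
        s₂ * ((p k).1 - (p k).2) := by
      rcases hy with rfl | rfl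
      · refine ⟨1, hone, fun k hk => ?_⟩
        have := (extent_mem (P := P) hk).2.1
        rw [ey₁, hP2, hP2] at this
        push_cast
        linarith
      · refine ⟨-1, hneg, fun k hk => ?_⟩
        have := (extent_mem (P := P) hk).2.2
        rw [ey₂, hP2, hP2] at this
        push_cast
        linarith
    obtain ⟨s₁, hs₁, hmin₁⟩ := hsx
    obtain ⟨s₂, hs₂, hmin₂⟩ := hsy
    rcases exists_corner (P := fun k => orient s₁ s₂ (p k)) (a := orient s₁ s₂ c)
      (b := orient s₁ s₂ d) (ra := rc) (rb := rd) hx' ((inSquare_orient hs₁ hs₂).mpr hxc) hmin₁ hy'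
      ((inSquare_orient hs₁ hs₂).mpr hyc) hmin₂ (fun k hk => by
        rw [inSquare_orient hs₁ hs₂, inSquare_orient hs₁ hs₂]
        exact hcov k hk) with h | ⟨i, hi, j, hj, h⟩
    · exact .inl (single c rc hrc fun k hk => (inSquare_orient hs₁ hs₂).mp (h k hk))
    · exact .inr ⟨s₁, s₂, hs₁, hs₂, i, hi, j, hj, h⟩
  have corner_a := corner a b ra rb ha hcov
  have corner_b := corner b a rb ra hb fun k hk => (hcov k hk).symm
  by_cases hA : ∃ x y, (x = x₁ ∨ x = x₂) ∧ (y = y₁ ∨ y = y₂) ∧ l1Dist (p x) a ≤ ra ∧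
      l1Dist (p y) a ≤ ra
  · obtain ⟨x, y, hx, hy, hxa, hya⟩ := hA
    rcases corner_a x y hx hy hxa hya with h | ⟨s₁, s₂, hs₁, hs₂, i, hi, j, hj, h⟩
    · exact .inl h
    · exact .inr ⟨s₁, s₂, hs₁, hs₂, i, hi, j, hj, .inl h⟩
  by_cases hB : ∃ x y, (x = x₁ ∨ x = x₂) ∧ (y = y₁ ∨ y = y₂) ∧ l1Dist (p x) b ≤ rb ∧
      l1Dist (p y) b ≤ rb
  · obtain ⟨x, y, hx, hy, hxa, hya⟩ := hB
    rcases corner_b x y hx hy hxa hya with h | ⟨s₁, s₂, hs₁, hs₂, i, hi, j, hj, h⟩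
    · exact .inl h
    · exact .inr ⟨s₁, s₂, hs₁, hs₂, i, hi, j, hj, .inr h⟩
  left
  push Not at hA hB
  have same : ∀ c r x₁' x₂', r ≤ R → l1Dist (p x₁') c ≤ r → l1Dist (p x₂') c ≤ r →
      (P x₂').1 - (P x₁').1 ≤ 2 * R ∧ (P x₂').2 - (P x₁').2 ≤ 2 * R := by
    intro c r x x' hr h h'
    rw [hsq] at h h'
    obtain ⟨h1, h2⟩ := h
    obtain ⟨h3, h4⟩ := h'
    rw [abs_le] at h1 h2 h3 h4
    constructor <;> linarith
  have hA11 := hA x₁ y₁ (.inl rfl) (.inl rfl)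
  have hA12 := hA x₁ y₂ (.inl rfl) (.inr rfl)
  have hA21 := hA x₂ y₁ (.inr rfl) (.inl rfl)
  have hA22 := hA x₂ y₂ (.inr rfl) (.inr rfl)
  have hB11 := hB x₁ y₁ (.inl rfl) (.inl rfl)
  have hB12 := hB x₁ y₂ (.inl rfl) (.inr rfl)
  have hB21 := hB x₂ y₁ (.inr rfl) (.inl rfl)
  have hB22 := hB x₂ y₂ (.inr rfl) (.inr rfl)
  have hall : (P x₂).1 - (P x₁).1 ≤ 2 * R ∧ (P y₂).2 - (P y₁).2 ≤ 2 * R := by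
    rw [← not_le] at hA11 hA12 hA21 hA22 hB11 hB12 hB21 hB22
    have c1 := hcov x₁ hx₁
    have c2 := hcov x₂ hx₂
    have c3 := hcov y₁ hy₁
    have c4 := hcov y₂ hy₂
    rcases c1 with c1 | c1
    · have c3 := c3.resolve_left (hA11 c1)
      have c4 := c4.resolve_left (hA12 c1)
      have c2 := c2.resolve_right fun h => hB21 h c3
      exact ⟨(same a ra x₁ x₂ ha c1 c2).1, (same b rb y₁ y₂ hb c3 c4).2⟩
    · have c3 := c3.resolve_right (hB11 c1)
      have c4 := c4.resolve_right (hB12 c1)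
      have c2 := c2.resolve_left fun h => hA21 h c3
      exact ⟨(same b rb x₁ x₂ hb c1 c2).1, (same a ra y₁ y₂ ha c3 c4).2⟩
  rw [Box.halfSide, ex₁, ex₂, ey₁, ey₂]
  rcases max_cases ((P x₂).1 - (P x₁).1) ((P y₂).2 - (P y₁).2) with h | h <;>
    linarith [hall.1, hall.2]

end Turnpike

/-! ### Optimal placements and candidate partitions -/

namespace Turnpike

/-- The facility may be moved to an end of the turnpike: if `t'` is the end closer to `f`, nobody
gains by riding towards `t`, and translating the turnpike by `f - t'` does not increase any travel
time. -/
theorem Placement.exists_facility_at_end (Q : Placement) (v : ℝ) (hv : 0 < v) :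
    ∃ f t, l2Dist t f = Q.length ∧ ∀ p, l1Dist p f ≤ Q.travelTime v p ∨
      l1Dist p t ≤ Q.travelTime v p - Q.length / v := by
  have tri : ∀ a b c : ℝ × ℝ, l1Dist a c ≤ l1Dist a b + l1Dist b c := by
    intro a b c
    simp only [l1Dist]
    linarith [abs_sub_le a.1 b.1 c.1, abs_sub_le a.2 b.2 c.2]
  have shift : ∀ p t t' f : ℝ × ℝ, l1Dist p (t + (f - t')) ≤ l1Dist p t + l1Dist t' f := by
    intro p t t' f
    refine (tri p t _).trans (add_le_add_right ?_ _)
    refine le_of_eq ?_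
    simp only [l1Dist, Prod.fst_add, Prod.snd_add, Prod.fst_sub, Prod.snd_sub]
    congr 1
    · congr 1; ring
    · congr 1; ring
  have hL : 0 ≤ Q.length / v := div_nonneg (Real.sqrt_nonneg _) hv.le
  have hlen : Q.length = l2Dist Q.t Q.t' := rfl
  rcases le_total (l1Dist Q.t' Q.f) (l1Dist Q.t Q.f) with h | h
  · refine ⟨Q.f, Q.t + (Q.f - Q.t'), ?_, fun p => ?_⟩
    · rw [hlen]
      simp only [l2Dist, Prod.fst_add, Prod.snd_add, Prod.fst_sub, Prod.snd_sub]
      ring_nf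
    · have h1 := tri p Q.t' Q.f
      have h2 := shift p Q.t Q.t' Q.f
      rw [travelTime]
      rcases min_choice (l1Dist p Q.f) (min (l1Dist p Q.t + Q.length / v + l1Dist Q.t' Q.f)
        (l1Dist p Q.t' + Q.length / v + l1Dist Q.t Q.f)) with e | e <;> rw [e]
      · exact .inl le_rfl
      · rcases min_choice (l1Dist p Q.t + Q.length / v + l1Dist Q.t' Q.f)
          (l1Dist p Q.t' + Q.length / v + l1Dist Q.t Q.f) with e | e <;> rw [e]
        · exact .inr (by linarith)
        · exact .inl (by linarith)
  · refine ⟨Q.f, Q.t' + (Q.f - Q.t), ?_, fun p => ?_⟩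
    · rw [hlen]
      simp only [l2Dist, Prod.fst_add, Prod.snd_add, Prod.fst_sub, Prod.snd_sub]
      ring_nf
    · have h1 := tri p Q.t Q.f
      have h2 := shift p Q.t' Q.t Q.f
      rw [travelTime]
      rcases min_choice (l1Dist p Q.f) (min (l1Dist p Q.t + Q.length / v + l1Dist Q.t' Q.f)
        (l1Dist p Q.t' + Q.length / v + l1Dist Q.t Q.f)) with e | e <;> rw [e]
      · exact .inl le_rfl
      · rcases min_choice (l1Dist p Q.t + Q.length / v + l1Dist Q.t' Q.f)
          (l1Dist p Q.t' + Q.length / v + l1Dist Q.t Q.f) with e | e <;> rw [e]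
        · exact .inl (by linarith)
        · exact .inr (by linarith)

/-- The clients as a sequence of points, continued by the origin. -/
noncomputable def clients {n : ℕ} (S : Fin n → ℝ × ℝ) (k : ℕ) : ℝ × ℝ :=
  if h : k < n then S ⟨k, h⟩ else 0

/-- The clients in rotated and reflected coordinates. -/
noncomputable def oriented {n : ℕ} (S : Fin n → ℝ × ℝ) (s₁ s₂ : ℚ) (k : ℕ) : ℝ × ℝ :=
  orient s₁ s₂ (clients S k)

theorem clients_val {n : ℕ} (S : Fin n → ℝ × ℝ) (i : Fin n) : clients S i = S i := by
  simp [clients]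

/-- The smaller radius of the two solutions in which the clients in a corner walk and the others
take the turnpike, or conversely. -/
noncomputable def candidateRadius (solve : BoxProblem → BoxSolution) (v ℓ : ℝ) (P : ℕ → ℝ × ℝ)
    (n i j : ℕ) : ℝ :=
  min (solve ⟨cornerBox P n i j, restBox P n i j, v, ℓ⟩).radius
    (solve ⟨restBox P n i j, cornerBox P n i j, v, ℓ⟩).radius

variable {Feas : ℝ → ℝ → Prop} {solve : BoxProblem → BoxSolution} {v ℓ : ℝ} {n : ℕ} [NeZero n]
  {S : Fin n → ℝ × ℝ}

theorem exists_candidateRadius_le (hs : IsSolver Feas solve) (hv : 1 < v) (hℓ : 0 ≤ ℓ)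
    (Q : Placement) (hQ : Feas ℓ Q.length) :
    (extent (oriented S 1 1) n).halfSide ≤ Q.radius v S ∨
    ∃ s₁ s₂, IsSign s₁ ∧ IsSign s₂ ∧ ∃ i < n, ∃ j < n,
      candidateRadius solve v ℓ (oriented S s₁ s₂) n i j ≤ Q.radius v S := by
  obtain ⟨f, t, hft, hcov⟩ := Q.exists_facility_at_end v (by linarith)
  have hlen : 0 ≤ Q.length := Real.sqrt_nonneg _
  have hL : 0 ≤ Q.length / v := div_nonneg hlen (by linarith)
  have hrad : ∀ k < n, Q.travelTime v (clients S k) ≤ Q.radius v S := by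
    intro k hk
    rw [clients, dif_pos hk]
    exact Finset.le_sup' (fun i => Q.travelTime v (S i)) (Finset.mem_univ (⟨k, hk⟩ : Fin n))
  rcases exists_partition (p := clients S) (Nat.pos_of_ne_zero (NeZero.ne n)) (a := f) (b := t)
    (ra := Q.radius v S) (rb := Q.radius v S - Q.length / v) (R := Q.radius v S) le_rfl
    (by linarith) (fun k hk => (hcov (clients S k)).imp (fun h => h.trans (hrad k hk))
      fun h => h.trans (by linarith [hrad k hk])) with h | ⟨s₁, s₂, h₁, h₂, i, hi, j, hj, h⟩
  · exact .inl h
  · have hdist := orient_sq_add_sq h₁ h₂ f t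
    rw [hft] at hdist
    refine .inr ⟨s₁, s₂, h₁, h₂, i, hi, j, hj, ?_⟩
    rcases h with ⟨hc, hr⟩ | ⟨hc, hr⟩
    · exact (min_le_left _ _).trans (hs.optimal _ _ _ _ _ hv hℓ hlen hQ ⟨hc, hr, hdist⟩)
    · exact (min_le_right _ _).trans (hs.optimal _ _ _ _ _ hv hℓ hlen hQ ⟨hr, hc, hdist⟩)

/-- `P` is an admissible placement of radius at most `R`. -/
def Achieves (Feas : ℝ → ℝ → Prop) (v ℓ : ℝ) (S : Fin n → ℝ × ℝ) (P : Placement) (R : ℝ) : Prop :=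
  Feas ℓ P.length ∧ P.radius v S ≤ R

/-- The placement given by a solution of a box problem. -/
noncomputable def BoxSolution.placement (s₁ s₂ : ℚ) (s : BoxSolution) : Placement :=
  ⟨unorient s₁ s₂ s.f, unorient s₁ s₂ s.t, unorient s₁ s₂ s.f⟩

theorem l1Dist_self (p : ℝ × ℝ) : l1Dist p p = 0 := by simp [l1Dist]

theorem BoxSolution.achieves (hs : IsSolver Feas solve) {D : BoxProblem} {s₁ s₂ : ℚ}
    (h₁ : IsSign s₁) (h₂ : IsSign s₂) (hv : 1 < D.v) (hℓ : 0 ≤ D.ℓ)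
    (hD : ∀ k < n, D.W.Mem (oriented S s₁ s₂ k) ∨ D.B.Mem (oriented S s₁ s₂ k)) :
    Achieves Feas D.v D.ℓ S ((solve D).placement s₁ s₂) (solve D).radius := by
  obtain ⟨len, hlen, hfeas, hW, hB, hd⟩ := hs.sound D hv hℓ
  have hlen' : ((solve D).placement s₁ s₂).length = len := by
    have h := orient_sq_add_sq h₁ h₂ (unorient s₁ s₂ (solve D).f) (unorient s₁ s₂ (solve D).t)
    rw [orient_unorient h₁ h₂, orient_unorient h₁ h₂, hd] at h
    have h' : ((solve D).placement s₁ s₂).length ^ 2 = len ^ 2 := by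
      simp only [Placement.length, placement]
      linarith
    exact (sq_eq_sq₀ (Real.sqrt_nonneg _) hlen).mp h'
  refine ⟨hlen' ▸ hfeas, Finset.sup'_le _ _ fun i _ => ?_⟩
  rw [Placement.travelTime, hlen']
  have hi := hD i i.2
  rw [oriented, clients_val] at hi
  rw [← orient_unorient h₁ h₂ (solve D).f] at hW
  rw [← orient_unorient h₁ h₂ (solve D).t] at hB
  rcases hi with hi | hi
  · exact (min_le_left _ _).trans ((inSquare_orient h₁ h₂).mp (hW.inSquare hi))
  · refine (min_le_right _ _).trans ((min_le_left _ _).trans ?_)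
    have := (inSquare_orient h₁ h₂).mp (hB.inSquare hi)
    simp only [placement, l1Dist_self]
    linarith

/-- The solution in which all clients walk to the center of their bounding box. -/
noncomputable def walkingPlacement (E : Box) (ℓ : ℝ) : Placement :=
  let c := unorient 1 1 ((E.x1 + E.x2) / 2, (E.y1 + E.y2) / 2)
  ⟨c, (c.1 + ℓ, c.2), c⟩

theorem walkingPlacement_achieves (hfeas : Feas ℓ ℓ) (hℓ : 0 ≤ ℓ) :
    Achieves Feas v ℓ S (walkingPlacement (extent (oriented S 1 1) n) ℓ)
      (extent (oriented S 1 1) n).halfSide := by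
  have hone : IsSign 1 := .inl rfl
  obtain ⟨E, hE⟩ : ∃ E, E = extent (oriented S 1 1) n := ⟨_, rfl⟩
  rw [← hE]
  constructor
  · have : (walkingPlacement E ℓ).length = ℓ := by
      simp [walkingPlacement, Placement.length, l2Dist, Real.sqrt_sq hℓ]
    rwa [this]
  · refine Finset.sup'_le _ _ fun i _ => (min_le_left _ _).trans ?_
    have hi := extent_mem (P := oriented S 1 1) i.2
    rw [oriented, clients_val, ← hE] at hi
    refine (inSquare_orient hone hone).mp (Box.Within.inSquare ?_ hi)
    simp only [walkingPlacement]
    rw [orient_unorient hone hone]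
    have h1 := le_max_left (E.x2 - E.x1) (E.y2 - E.y1)
    have h2 := le_max_right (E.x2 - E.x1) (E.y2 - E.y1)
    refine ⟨?_, ?_, ?_, ?_⟩ <;> simp only [Box.halfSide] <;> linarith

end Turnpike

/-! ### The program -/

namespace Turnpike

open RealRAM

/-- Execute the programs of a list one after the other. -/
def block : List Prog → Prog
  | [] => .skip
  | p :: l => .seq p (block l)

theorem Runs.block_nil {n : ℕ} {σ : State} {Q : State → Prop} (h : Q σ) :
    Runs n (block []) σ Q := Runs.skip h

theorem Runs.block_cons {n : ℕ} {p : Prog} {l : List Prog} {σ : State} {Q : State → Prop}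
    (h : Runs n p σ fun τ => Runs n (block l) τ Q) : Runs n (block (p :: l)) σ Q := Runs.seq h

/-- An expression for the minimum of two real registers. -/
noncomputable def minReg (a b : ℕ) : RExpr := ((Expressible.reg a).min (.reg b)).choose

/-- An expression for the maximum of two real registers. -/
noncomputable def maxReg (a b : ℕ) : RExpr := ((Expressible.reg a).max (.reg b)).choose

@[simp] theorem eval_minReg (σ : State) (a b : ℕ) :
    (minReg a b).eval σ = min (σ.reg a) (σ.reg b) :=
  ((Expressible.reg a).min (.reg b)).choose_spec σ

@[simp] theorem eval_maxReg (σ : State) (a b : ℕ) :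
    (maxReg a b).eval σ = max (σ.reg a) (σ.reg b) :=
  ((Expressible.reg a).max (.reg b)).choose_spec σ

/-- The box in the real registers `a, …, a + 3`. -/
def readBox (σ : State) (a : ℕ) : Box := ⟨σ.reg a, σ.reg (a + 1), σ.reg (a + 2), σ.reg (a + 3)⟩

/-- The box problem in the real registers `20, …, 27`, with the parameters `v` and `ℓ` in the
registers `7` and `8`. -/
def readProblem (σ : State) : BoxProblem := ⟨readBox σ 20, readBox σ 24, σ.reg 7, σ.reg 8⟩

theorem expressible_readProblem : ExpressibleProblem readProblem :=
  ⟨.reg _, .reg _, .reg _, .reg _, .reg _, .reg _, .reg _, .reg _, .reg _, .reg _⟩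

/-- Expressions that compute the solution of the box problem `readProblem`. -/
structure Code where
  radius : RExpr
  fx : RExpr
  fy : RExpr
  tx : RExpr
  ty : RExpr

/-- The values of the five expressions are the coordinates of the solution that `solve` finds. -/
structure Code.Computes (e : Code) (solve : BoxProblem → BoxSolution) : Prop where
  radius : ∀ σ, e.radius.eval σ = (solve (readProblem σ)).radius
  fx : ∀ σ, e.fx.eval σ = (solve (readProblem σ)).f.1
  fy : ∀ σ, e.fy.eval σ = (solve (readProblem σ)).f.2
  tx : ∀ σ, e.tx.eval σ = (solve (readProblem σ)).t.1
  ty : ∀ σ, e.ty.eval σ = (solve (readProblem σ)).t.2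

theorem IsSolver.exists_code {Feas : ℝ → ℝ → Prop} {solve : BoxProblem → BoxSolution}
    (hs : IsSolver Feas solve) : ∃ e : Code, e.Computes solve := by
  obtain ⟨⟨a, ha⟩, ⟨b, hb⟩, ⟨c, hc⟩, ⟨d, hd⟩, ⟨e, he⟩⟩ := hs.expressible _ expressible_readProblem
  exact ⟨⟨a, b, c, d, e⟩, ha, hb, hc, hd, he⟩

/-- Accumulate in the registers `15, …, 18` the bounding box of the points that satisfy `c`. The
points are in the arrays `2` and `3`, and the current point is in the registers `13` and `14`. -/
noncomputable def scan (c : Cond) : Prog :=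
  forLoop 2 (block [.load 13 2 (.var 2), .load 14 3 (.var 2),
    .branch c (block [.setReg 15 (minReg 15 13), .setReg 16 (maxReg 16 13),
      .setReg 17 (minReg 17 14), .setReg 18 (maxReg 18 14)]) .skip])

/-- Fill the arrays `2` and `3` with the rotated and reflected coordinates of the clients. -/
def rotate (s₁ s₂ : ℚ) : Prog :=
  forLoop 1 (block [.load 13 0 (.var 1), .load 14 1 (.var 1),
    .store 2 (.var 1) (.mul (.const s₁) (.add (.reg 13) (.reg 14))),
    .store 3 (.var 1) (.mul (.const s₂) (.sub (.reg 13) (.reg 14)))])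

/-- Put the bounding box of all clients into the registers `9, …, 12`. -/
noncomputable def findExtent : Prog :=
  block [.load 15 2 (.const 0), .setReg 16 (.reg 15), .load 17 3 (.const 0), .setReg 18 (.reg 17),
    scan (.idxLe (.const 0) (.const 0)),
    .setReg 9 (.reg 15), .setReg 10 (.reg 16), .setReg 11 (.reg 17), .setReg 12 (.reg 18)]

/-- Put the bounding box of the clients that satisfy `c` into the registers `15, …, 18`. -/
noncomputable def freshScan (c : Cond) : Prog :=
  block [.setReg 15 (.reg 10), .setReg 16 (.reg 9), .setReg 17 (.reg 12), .setReg 18 (.reg 11),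
    scan c]

/-- Fill the arrays `4, …, 7` with the bounding boxes of the clients above each of the clients. -/
noncomputable def findUpper : Prog :=
  forLoop 1 (block [.load 19 3 (.var 1), freshScan (.realLt (.reg 19) (.reg 14)),
    .store 4 (.var 1) (.reg 15), .store 5 (.var 1) (.reg 16),
    .store 6 (.var 1) (.reg 17), .store 7 (.var 1) (.reg 18)])

/-- The abscissa of `unorient s₁ s₂` of the point in the registers `a` and `a + 1`. -/
def unorientX (s₁ s₂ : ℚ) (a : ℕ) : RExpr :=
  .div (.add (.mul (.const s₁) (.reg a)) (.mul (.const s₂) (.reg (a + 1)))) (.const 2)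

/-- The ordinate of `unorient s₁ s₂` of the point in the registers `a` and `a + 1`. -/
def unorientY (s₁ s₂ : ℚ) (a : ℕ) : RExpr :=
  .div (.sub (.mul (.const s₁) (.reg a)) (.mul (.const s₂) (.reg (a + 1)))) (.const 2)

/-- Solve the box problem, and keep the solution if it is the best one so far: the registers
`0, …, 5` hold the best placement and the register `6` its radius. -/
def improve (e : Code) (s₁ s₂ : ℚ) : Prog :=
  block [.setReg 28 e.radius,
    .branch (.realLt (.reg 28) (.reg 6))
      (block [.setReg 6 (.reg 28), .setReg 29 e.fx, .setReg 30 e.fy, .setReg 31 e.tx,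
        .setReg 32 e.ty, .setReg 0 (unorientX s₁ s₂ 29), .setReg 1 (unorientY s₁ s₂ 29),
        .setReg 2 (unorientX s₁ s₂ 31), .setReg 3 (unorientY s₁ s₂ 31),
        .setReg 4 (.reg 0), .setReg 5 (.reg 1)])
      .skip]

/-- Put the corner and the bounding box of the rest into the registers from `a` and from `b` on. The
abscissa of client `i` is in the register `19` and the ordinate of client `j` in `14`, the box of the
clients to the right of `i` in `15, …, 18`, and that of the clients above `j` in `33, …, 36`. -/
noncomputable def setBoxes (a b : ℕ) : Prog :=
  block [.setReg a (.reg 9), .setReg (a + 1) (.reg 19), .setReg (a + 2) (.reg 11),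
    .setReg (a + 3) (.reg 14), .setReg b (minReg 15 33), .setReg (b + 1) (maxReg 16 34),
    .setReg (b + 2) (minReg 17 35), .setReg (b + 3) (maxReg 18 36)]

/-- Load the ordinate of a client into register `14`, and the bounding box of the clients above it
into the registers `33, …, 36`. -/
def loadUpper : Prog :=
  block [.load 14 3 (.var 2), .load 33 4 (.var 2), .load 34 5 (.var 2), .load 35 6 (.var 2),
    .load 36 7 (.var 2)]

/-- Try the two candidates of one pair of clients. -/
noncomputable def tryPair (e : Code) (s₁ s₂ : ℚ) : Prog :=
  block [loadUpper, setBoxes 20 24, improve e s₁ s₂, setBoxes 24 20, improve e s₁ s₂]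

/-- Try the candidates of all pairs of clients. -/
noncomputable def tryPairs (e : Code) (s₁ s₂ : ℚ) : Prog :=
  forLoop 1 (block [.load 19 2 (.var 1), freshScan (.realLt (.reg 19) (.reg 13)),
    forLoop 2 (tryPair e s₁ s₂)])

/-- Try all candidates in one of the four orientations. -/
noncomputable def phase (e : Code) (s₁ s₂ : ℚ) : Prog :=
  block [rotate s₁ s₂, findExtent, findUpper, tryPairs e s₁ s₂]

/-- Start with the placement in which all clients walk. -/
noncomputable def startWalking : Prog :=
  block [.setReg 13 (.sub (.reg 10) (.reg 9)), .setReg 14 (.sub (.reg 12) (.reg 11)),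
    .setReg 6 (.div (maxReg 13 14) (.const 2)),
    .setReg 29 (.div (.add (.reg 9) (.reg 10)) (.const 2)),
    .setReg 30 (.div (.add (.reg 11) (.reg 12)) (.const 2)),
    .setReg 0 (unorientX 1 1 29), .setReg 1 (unorientY 1 1 29),
    .setReg 2 (.add (.reg 0) (.reg 8)), .setReg 3 (.reg 1),
    .setReg 4 (.reg 0), .setReg 5 (.reg 1)]

/-- Move `v` and `ℓ` to the registers `7` and `8`. -/
def moveParameters : Prog := block [.setReg 7 (.reg 0), .setReg 8 (.reg 1)]

/-- The program for both problems: in the variable-length problem `ℓ = 0`, which is an admissible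
length for `startWalking` and is not used by the expressions in `e`. -/
noncomputable def program (e : Code) : Prog :=
  block [moveParameters, rotate 1 1, findExtent, startWalking,
    phase e 1 1, phase e 1 (-1), phase e (-1) 1, phase e (-1) (-1)]

theorem depth_program (e : Code) : (program e).depth ≤ 2 := by
  simp [program, moveParameters, phase, startWalking, tryPairs, tryPair, loadUpper, setBoxes, improve, findUpper, freshScan,
    findExtent, rotate, scan, forLoop, block, Prog.depth]

/-! ### Correctness of the program -/

variable {n : ℕ} {σ : State} {P : ℕ → ℝ × ℝ}

/-- Index register `0` holds `n`, and the arrays `2` and `3` hold the points `P 0, …, P (n - 1)`. -/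
structure Holds (n : ℕ) (P : ℕ → ℝ × ℝ) (σ : State) : Prop where
  size : σ.idx 0 = n
  x : ∀ k < n, σ.arr 2 k = (P k).1
  y : ∀ k < n, σ.arr 3 k = (P k).2

theorem Holds.congr {τ : State} (h : Holds n P σ) (h0 : τ.idx 0 = σ.idx 0)
    (h2 : τ.arr 2 = σ.arr 2) (h3 : τ.arr 3 = σ.arr 3) : Holds n P τ :=
  ⟨h0 ▸ h.size, fun k hk => by rw [h2, h.x k hk], fun k hk => by rw [h3, h.y k hk]⟩

theorem runs_scan {c : Cond} {C : ℝ × ℝ → Prop} (h : Holds n P σ)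
    (hc : ∀ τ : State, τ.reg 19 = σ.reg 19 → (c.Holds τ ↔ C (τ.reg 13, τ.reg 14))) :
    Runs n (scan c) σ fun τ => readBox τ 15 = scanBox (readBox σ 15) C P n := by
  refine Runs.forLoop (fun k τ => readBox τ 15 = scanBox (readBox σ 15) C P k)
    (fun k τ τ' h1 _ h => ?_) h.size (by simp) (by simp [block, Prog.modIdx])
    (by simp [block, Prog.modIdx]) rfl fun k hk τ hτ hf hI => ?_
  · simpa [readBox, h1] using h
  · have hx : τ.arr 2 k = (P k).1 := by
      rw [hf.arr 2 (by simp [forLoop, block, Prog.modArr]), h.x k hk]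
    have hy : τ.arr 3 k = (P k).2 := by
      rw [hf.arr 3 (by simp [forLoop, block, Prog.modArr]), h.y k hk]
    have h19 : τ.reg 19 = σ.reg 19 := hf.reg 19 (by simp [forLoop, block, Prog.modReg])
    refine Runs.block_cons (Runs.load (by simpa [IExpr.eval, hτ] using hk) ?_)
    refine Runs.block_cons (Runs.load (by simpa [IExpr.eval, hτ] using hk) ?_)
    refine Runs.block_cons (Runs.branch (fun hC => ?_) fun hC => ?_)
    · rw [hc _ (by simpa using h19)] at hC
      simp only [IExpr.eval, hτ, hx, hy] at hC
      refine Runs.block_cons (Runs.setReg ?_)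
      refine Runs.block_cons (Runs.setReg ?_)
      refine Runs.block_cons (Runs.setReg ?_)
      refine Runs.block_cons (Runs.setReg ?_)
      refine Runs.block_nil (Runs.block_nil ?_)
      rw [scanBox, if_pos (by simpa using hC), ← hI]
      simp [readBox, Box.join, Box.point, IExpr.eval, hτ, hx, hy]
    · rw [hc _ (by simpa using h19)] at hC
      simp only [IExpr.eval, hτ, hx, hy] at hC
      refine Runs.skip (Runs.block_nil ?_)
      rw [scanBox, if_neg (by simpa using hC), ← hI]
      simp [readBox]

theorem runs_rotate {s₁ s₂ : ℚ} {p : ℕ → ℝ × ℝ} (h0 : σ.idx 0 = n)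
    (hx : ∀ k < n, σ.arr 0 k = (p k).1) (hy : ∀ k < n, σ.arr 1 k = (p k).2) :
    Runs n (rotate s₁ s₂) σ (Holds n fun k => orient s₁ s₂ (p k)) := by
  refine (Runs.forLoop (p := block _) (fun k τ => ∀ i < k,
      τ.arr 2 i = (orient s₁ s₂ (p i)).1 ∧ τ.arr 3 i = (orient s₁ s₂ (p i)).2)
    (fun k τ τ' _ h2 h => by simpa [h2] using h) h0 (by simp) (by simp [block, Prog.modIdx])
    (by simp [block, Prog.modIdx]) (fun i hi => by omega) fun k hk τ hτ hf hI => ?_).mono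
      fun τ hf hτ => ⟨?_, fun k hk => (hτ k hk).1, fun k hk => (hτ k hk).2⟩
  · have hx : τ.arr 0 k = (p k).1 := by
      rw [hf.arr 0 (by simp [forLoop, block, Prog.modArr]), hx k hk]
    have hy : τ.arr 1 k = (p k).2 := by
      rw [hf.arr 1 (by simp [forLoop, block, Prog.modArr]), hy k hk]
    refine Runs.block_cons (Runs.load (by simpa [IExpr.eval, hτ] using hk) ?_)
    refine Runs.block_cons (Runs.load (by simpa [IExpr.eval, hτ] using hk) ?_)
    refine Runs.block_cons (Runs.store (by simpa [IExpr.eval, hτ] using hk) ?_)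
    refine Runs.block_cons (Runs.store (by simpa [IExpr.eval, hτ] using hk) ?_)
    refine Runs.block_nil fun i hi => ?_
    rcases Nat.lt_succ_iff_lt_or_eq.mp hi with hik | rfl
    · have := hI i hik
      simpa [IExpr.eval, hτ, hik.ne] using this
    · simp [IExpr.eval, RExpr.eval, hτ, hx, hy, orient]
  · rw [hf.idx 0 (by simp [forLoop, block, Prog.modIdx]), h0]

theorem runs_findExtent (hn : 0 < n) (h : Holds n P σ) :
    Runs n findExtent σ fun τ => readBox τ 9 = extent P n := by
  refine Runs.block_cons (Runs.load hn ?_)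
  refine Runs.block_cons (Runs.setReg ?_)
  refine Runs.block_cons (Runs.load hn ?_)
  refine Runs.block_cons (Runs.setReg ?_)
  refine Runs.block_cons (Runs.mono (runs_scan (P := P) (C := fun _ => True)
    (h.congr rfl rfl rfl) fun τ _ => by simp [Cond.Holds]) fun τ hf hτ => ?_)
  refine Runs.block_cons (Runs.setReg ?_)
  refine Runs.block_cons (Runs.setReg ?_)
  refine Runs.block_cons (Runs.setReg ?_)
  refine Runs.block_cons (Runs.setReg (Runs.block_nil ?_))
  have e : readBox τ 15 = extent P n := by
    rw [hτ, extent]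
    simp [readBox, Box.point, IExpr.eval, RExpr.eval, h.x 0 hn, h.y 0 hn]
  rw [← e]
  simp [readBox, RExpr.eval]

theorem runs_freshScan {c : Cond} {C : ℝ × ℝ → Prop} (h : Holds n P σ)
    (hE : readBox σ 9 = extent P n)
    (hc : ∀ τ : State, τ.reg 19 = σ.reg 19 → (c.Holds τ ↔ C (τ.reg 13, τ.reg 14))) :
    Runs n (freshScan c) σ fun τ => readBox τ 15 = scanBox (extent P n).flip C P n := by
  refine Runs.block_cons (Runs.setReg ?_)
  refine Runs.block_cons (Runs.setReg ?_)
  refine Runs.block_cons (Runs.setReg ?_)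
  refine Runs.block_cons (Runs.setReg ?_)
  refine Runs.block_cons (Runs.mono (runs_scan (P := P) (C := C) (h.congr rfl rfl rfl)
    fun τ hτ => ?_) fun τ hf hτ => Runs.block_nil ?_)
  · exact hc τ (by simpa using hτ)
  · rw [hτ, ← hE]
    simp [readBox, Box.flip, RExpr.eval]

/-- The arrays `4, …, 7` hold the boxes `upperBox P n j`. -/
def HoldsUpper (n : ℕ) (P : ℕ → ℝ × ℝ) (m : ℕ) (σ : State) : Prop :=
  ∀ j < m, (⟨σ.arr 4 j, σ.arr 5 j, σ.arr 6 j, σ.arr 7 j⟩ : Box) = upperBox P n j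

theorem runs_findUpper (h : Holds n P σ) (hE : readBox σ 9 = extent P n) :
    Runs n findUpper σ (HoldsUpper n P n) := by
  refine Runs.forLoop (HoldsUpper n P) (fun k τ τ' _ h2 h => by simpa [HoldsUpper, h2] using h)
    h.size (by simp) (by simp [block, freshScan, scan, forLoop, Prog.modIdx])
    (by simp [block, freshScan, scan, forLoop, Prog.modIdx]) (fun i hi => by omega)
    fun k hk τ hτ hf hI => ?_
  have hτP : Holds n P τ := h.congr
    (hf.idx 0 (by simp [block, freshScan, scan, forLoop, Prog.modIdx]))
    (hf.arr 2 (by simp [block, freshScan, scan, forLoop, Prog.modArr]))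
    (hf.arr 3 (by simp [block, freshScan, scan, forLoop, Prog.modArr]))
  have hτE : readBox τ 9 = extent P n := by
    rw [← hE]
    simp [readBox, hf.reg 9 (by simp [block, freshScan, scan, forLoop, Prog.modReg]),
      hf.reg 10 (by simp [block, freshScan, scan, forLoop, Prog.modReg]),
      hf.reg 11 (by simp [block, freshScan, scan, forLoop, Prog.modReg]),
      hf.reg 12 (by simp [block, freshScan, scan, forLoop, Prog.modReg])]
  refine Runs.block_cons (Runs.load (by simpa [IExpr.eval, hτ] using hk) ?_)
  refine Runs.block_cons (Runs.mono (runs_freshScan (P := P) (C := fun p => (P k).2 < p.2)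
    (hτP.congr rfl rfl rfl) (by simpa [readBox] using hτE) fun ρ hρ => ?_) fun ρ hg hρ => ?_)
  · simp [Cond.Holds, RExpr.eval, hρ, IExpr.eval, hτ, hτP.y k hk]
  · have hρ1 : ρ.idx 1 = k := by
      rw [hg.idx 1 (by simp [block, freshScan, scan, forLoop, Prog.modIdx])]
      exact hτ
    have harr : ρ.arr = τ.arr := funext fun a =>
      hg.arr a (by simp [block, freshScan, scan, forLoop, Prog.modArr])
    refine Runs.block_cons (Runs.store (by simpa [IExpr.eval, hρ1] using hk) ?_)
    refine Runs.block_cons (Runs.store (by simpa [IExpr.eval, hρ1] using hk) ?_)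
    refine Runs.block_cons (Runs.store (by simpa [IExpr.eval, hρ1] using hk) ?_)
    refine Runs.block_cons (Runs.store (by simpa [IExpr.eval, hρ1] using hk) ?_)
    refine Runs.block_nil fun i hi => ?_
    rcases Nat.lt_succ_iff_lt_or_eq.mp hi with hik | rfl
    · have := hI i hik
      simpa [IExpr.eval, hρ1, hik.ne, harr] using this
    · rw [upperBox, ← hρ]
      simp [IExpr.eval, RExpr.eval, hρ1, readBox]

theorem runs_setBoxes {a b : ℕ} {X Y : Box} (hab : (a = 20 ∧ b = 24) ∨ (a = 24 ∧ b = 20))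
    (hX : (⟨σ.reg 9, σ.reg 19, σ.reg 11, σ.reg 14⟩ : Box) = X)
    (hY : (readBox σ 15).join (readBox σ 33) = Y) :
    Runs n (setBoxes a b) σ fun τ => readBox τ a = X ∧ readBox τ b = Y := by
  refine Runs.block_cons (Runs.setReg (Runs.block_cons (Runs.setReg ?_)))
  refine Runs.block_cons (Runs.setReg (Runs.block_cons (Runs.setReg ?_)))
  refine Runs.block_cons (Runs.setReg (Runs.block_cons (Runs.setReg ?_)))
  refine Runs.block_cons (Runs.setReg (Runs.block_cons (Runs.setReg ?_)))
  refine Runs.block_nil ?_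
  rw [← hX, ← hY]
  rcases hab with ⟨rfl, rfl⟩ | ⟨rfl, rfl⟩ <;> simp [readBox, Box.join, RExpr.eval]

section Candidates

variable {Feas : ℝ → ℝ → Prop} {solve : BoxProblem → BoxSolution} {v ℓ : ℝ} [NeZero n]
  {S : Fin n → ℝ × ℝ} {e : Code} {s₁ s₂ : ℚ}

/-- The best placement so far is admissible, has at most the radius in register `6`, and the latter
is a lower bound of `B`. -/
def Best (Feas : ℝ → ℝ → Prop) (v ℓ : ℝ) (S : Fin n → ℝ × ℝ) (B : Set ℝ) (σ : State) : Prop :=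
  Achieves Feas v ℓ S (output σ) (σ.reg 6) ∧ ∀ R ∈ B, σ.reg 6 ≤ R

theorem Best.congr {B : Set ℝ} {τ : State} (h : Best Feas v ℓ S B σ)
    (hr : ∀ r ≤ 6, τ.reg r = σ.reg r) : Best Feas v ℓ S B τ := by
  simpa [Best, output, hr] using h

theorem Best.mono {B B' : Set ℝ} (h : Best Feas v ℓ S B σ) (hB : ∀ R ∈ B', ∃ R' ∈ B, R' ≤ R) :
    Best Feas v ℓ S B' σ :=
  ⟨h.1, fun R hR => by
    obtain ⟨R', hR', hle⟩ := hB R hR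
    exact (h.2 R' hR').trans hle⟩

theorem runs_improve (hs : IsSolver Feas solve) (he : e.Computes solve) (h₁ : IsSign s₁)
    (h₂ : IsSign s₂) (hv : 1 < v) (hℓ : 0 ≤ ℓ) {D : BoxProblem} (hσ : readProblem σ = D)
    (hDv : D.v = v) (hDℓ : D.ℓ = ℓ)
    (hD : ∀ k < n, D.W.Mem (oriented S s₁ s₂ k) ∨ D.B.Mem (oriented S s₁ s₂ k)) {B : Set ℝ}
    (hB : Best Feas v ℓ S B σ) :
    Runs n (improve e s₁ s₂) σ (Best Feas v ℓ S (insert (solve D).radius B)) := by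
  have hach := BoxSolution.achieves (S := S) hs h₁ h₂ (hDv ▸ hv) (hDℓ ▸ hℓ) hD
  rw [hDv, hDℓ] at hach
  have hread : ∀ reg : ℕ → ℝ, (∀ r, r = 7 ∨ r = 8 ∨ (20 ≤ r ∧ r < 28) → reg r = σ.reg r) →
      readProblem { σ with reg := reg } = D := by
    intro reg hreg
    rw [← hσ]
    simp [readProblem, readBox, hreg]
  refine Runs.block_cons (Runs.setReg (Runs.block_cons (Runs.branch (fun hC => ?_) fun hC => ?_)))
  · have hlt : (solve D).radius < σ.reg 6 := by
      simpa [Cond.Holds, RExpr.eval, he.radius, hσ] using hC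
    refine Runs.block_cons (Runs.setReg (Runs.block_cons (Runs.setReg ?_)))
    rw [he.fx, hread _ (by intro r hr; simp; grind)]
    refine Runs.block_cons (Runs.setReg ?_)
    rw [he.fy, hread _ (by intro r hr; simp; grind)]
    refine Runs.block_cons (Runs.setReg ?_)
    rw [he.tx, hread _ (by intro r hr; simp; grind)]
    refine Runs.block_cons (Runs.setReg ?_)
    rw [he.ty, hread _ (by intro r hr; simp; grind)]
    refine Runs.block_cons (Runs.setReg (Runs.block_cons (Runs.setReg ?_)))
    refine Runs.block_cons (Runs.setReg (Runs.block_cons (Runs.setReg ?_)))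
    refine Runs.block_cons (Runs.setReg (Runs.block_cons (Runs.setReg ?_)))
    refine Runs.block_nil (Runs.block_nil ?_)
    have hach' : Achieves Feas v ℓ S ((solve D).placement s₁ s₂) (solve D).radius := hach
    simp only [BoxSolution.placement, unorient] at hach'
    refine ⟨?_, fun R hR => ?_⟩
    · simpa [output, RExpr.eval, he.radius, hσ, unorientX, unorientY] using hach'
    · rcases hR with rfl | hR
      · simp [RExpr.eval, he.radius, hσ]
      · simpa [RExpr.eval, he.radius, hσ] using hlt.le.trans (hB.2 R hR)
  · have hle : σ.reg 6 ≤ (solve D).radius := by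
      simpa [Cond.Holds, RExpr.eval, he.radius, hσ] using hC
    refine Runs.skip (Runs.block_nil (Best.congr (σ := σ) ⟨hB.1, fun R hR => ?_⟩ fun r hr => ?_))
    · rcases hR with rfl | hR
      · exact hle
      · exact hB.2 R hR
    · have : r ≠ 28 := by omega
      simp [this]

end Candidates

theorem runs_loadUpper {j : ℕ} (h : Holds n P σ) (hU : HoldsUpper n P n σ) (hj : j < n)
    (hσ : σ.idx 2 = j) :
    Runs n loadUpper σ fun τ => τ.reg 14 = (P j).2 ∧ readBox τ 33 = upperBox P n j := by
  refine Runs.block_cons (Runs.load (by simpa [IExpr.eval, hσ] using hj) ?_)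
  refine Runs.block_cons (Runs.load (by simpa [IExpr.eval, hσ] using hj) ?_)
  refine Runs.block_cons (Runs.load (by simpa [IExpr.eval, hσ] using hj) ?_)
  refine Runs.block_cons (Runs.load (by simpa [IExpr.eval, hσ] using hj) ?_)
  refine Runs.block_cons (Runs.load (by simpa [IExpr.eval, hσ] using hj) (Runs.block_nil ?_))
  rw [← hU j hj]
  simp [readBox, IExpr.eval, hσ, h.y j hj]

theorem readBox_congr {τ : State} {a : ℕ} {b : Box} (h : readBox σ a = b)
    (h0 : τ.reg a = σ.reg a) (h1 : τ.reg (a + 1) = σ.reg (a + 1))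
    (h2 : τ.reg (a + 2) = σ.reg (a + 2)) (h3 : τ.reg (a + 3) = σ.reg (a + 3)) :
    readBox τ a = b := by
  rw [← h, readBox, h0, h1, h2, h3, readBox]

section Input

variable {v ℓ : ℝ} {S : Fin n → ℝ × ℝ}

/-- The input is available: `n`, the coordinates of the clients, `v` and `ℓ`. -/
structure HasInput (v ℓ : ℝ) (S : Fin n → ℝ × ℝ) (σ : State) : Prop where
  size : σ.idx 0 = n
  x : ∀ k < n, σ.arr 0 k = (clients S k).1
  y : ∀ k < n, σ.arr 1 k = (clients S k).2
  v : σ.reg 7 = v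
  ℓ : σ.reg 8 = ℓ

theorem HasInput.congr {τ : State} (h : HasInput v ℓ S σ) (hi : τ.idx 0 = σ.idx 0)
    (h0 : τ.arr 0 = σ.arr 0) (h1 : τ.arr 1 = σ.arr 1) (h7 : τ.reg 7 = σ.reg 7)
    (h8 : τ.reg 8 = σ.reg 8) : HasInput v ℓ S τ :=
  ⟨hi ▸ h.size, fun k hk => by rw [h0, h.x k hk], fun k hk => by rw [h1, h.y k hk],
    h7 ▸ h.v, h8 ▸ h.ℓ⟩

theorem runs_moveParameters : Runs n moveParameters (input v ℓ S) (HasInput v ℓ S) := by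
  refine Runs.block_cons (Runs.setReg (Runs.block_cons (Runs.setReg (Runs.block_nil ?_))))
  exact ⟨by simp [input], fun k hk => by simp [input, clients, hk],
    fun k hk => by simp [input, clients, hk], by simp [RExpr.eval, input],
    by simp [RExpr.eval, input]⟩

end Input

section Candidates

variable {Feas : ℝ → ℝ → Prop} {solve : BoxProblem → BoxSolution} {v ℓ : ℝ} [NeZero n]
  {S : Fin n → ℝ × ℝ} {e : Code} {s₁ s₂ : ℚ}

theorem runs_tryPair (hs : IsSolver Feas solve) (he : e.Computes solve) (h₁ : IsSign s₁)
    (h₂ : IsSign s₂) (hv : 1 < v) (hℓ : 0 ≤ ℓ) {i j : ℕ} (hP : Holds n (oriented S s₁ s₂) σ)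
    (hU : HoldsUpper n (oriented S s₁ s₂) n σ) (hE : readBox σ 9 = extent (oriented S s₁ s₂) n)
    (h7 : σ.reg 7 = v) (h8 : σ.reg 8 = ℓ) (h19 : σ.reg 19 = (oriented S s₁ s₂ i).1)
    (h15 : readBox σ 15 = rightBox (oriented S s₁ s₂) n i) (hj : j < n) (hσ : σ.idx 2 = j)
    {B : Set ℝ} (hB : Best Feas v ℓ S B σ) :
    Runs n (tryPair e s₁ s₂) σ
      (Best Feas v ℓ S (insert (candidateRadius solve v ℓ (oriented S s₁ s₂) n i j) B)) := by
  obtain ⟨P, hPdef⟩ : ∃ P, P = oriented S s₁ s₂ := ⟨_, rfl⟩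
  have hboxes : ∀ τ : State, τ.reg 9 = σ.reg 9 → τ.reg 11 = σ.reg 11 → τ.reg 19 = σ.reg 19 →
      τ.reg 14 = (P j).2 →
      (⟨τ.reg 9, τ.reg 19, τ.reg 11, τ.reg 14⟩ : Box) = cornerBox P n i j := by
    intro τ t9 t11 t19 t14
    rw [t9, t11, t19, t14, h19, cornerBox, hPdef, ← hE]
    rfl
  rw [← hPdef] at hP hU h15 ⊢
  refine Runs.block_cons (Runs.mono (runs_loadUpper hP hU hj hσ) fun σ₁ f₁ hσ₁ => ?_)
  have hf₁ : ∀ r < 13, σ₁.reg r = σ.reg r := fun r hr =>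
    f₁.reg r (by simp [loadUpper, block, Prog.modReg]; omega)
  have hf₁' : ∀ r, 15 ≤ r → r ≤ 19 → σ₁.reg r = σ.reg r := fun r hr hr' =>
    f₁.reg r (by simp [loadUpper, block, Prog.modReg]; omega)
  have h15₁ : readBox σ₁ 15 = rightBox P n i := readBox_congr h15 (hf₁' _ (by simp) (by simp))
    (hf₁' _ (by simp) (by simp)) (hf₁' _ (by simp) (by simp)) (hf₁' _ (by simp) (by simp))
  have hB₁ := hB.congr fun r hr => hf₁ r (by omega)
  refine Runs.block_cons (Runs.mono (runs_setBoxes (X := cornerBox P n i j) (Y := restBox P n i j)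
    (.inl ⟨rfl, rfl⟩) (hboxes σ₁ (hf₁ 9 (by simp)) (hf₁ 11 (by simp))
      (hf₁' 19 (by simp) (by simp)) hσ₁.1) (by rw [h15₁, hσ₁.2]; rfl)) fun σ₂ f₂ hσ₂ => ?_)
  have hf₂ : ∀ r, r < 20 ∨ 28 ≤ r → σ₂.reg r = σ₁.reg r := fun r hr =>
    f₂.reg r (by simp [setBoxes, block, Prog.modReg]; omega)
  have hB₂ := hB₁.congr fun r hr => hf₂ r (by omega)
  have e7 : σ₂.reg 7 = v := by rw [hf₂ 7 (by simp), hf₁ 7 (by simp), h7]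
  have e8 : σ₂.reg 8 = ℓ := by rw [hf₂ 8 (by simp), hf₁ 8 (by simp), h8]
  refine Runs.block_cons (Runs.mono (runs_improve hs he h₁ h₂ hv hℓ
    (D := ⟨cornerBox P n i j, restBox P n i j, v, ℓ⟩)
    (by rw [readProblem, hσ₂.1, hσ₂.2, e7, e8]) rfl rfl
    (fun k hk => hPdef ▸ cornerBox_or_restBox hk) hB₂) fun σ₃ f₃ hB₃ => ?_)
  have hf₃ : ∀ r, (7 ≤ r ∧ r < 28) ∨ 33 ≤ r → σ₃.reg r = σ₂.reg r := fun r hr =>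
    f₃.reg r (by simp [improve, block, Prog.modReg]; omega)
  have hf₃' : ∀ r, (7 ≤ r ∧ r < 20) ∨ 33 ≤ r → σ₃.reg r = σ₁.reg r := fun r hr => by
    rw [hf₃ r (by omega), hf₂ r (by omega)]
  refine Runs.block_cons (Runs.mono (runs_setBoxes (X := cornerBox P n i j) (Y := restBox P n i j)
    (.inr ⟨rfl, rfl⟩) (hboxes σ₃ ((hf₃' 9 (by simp)).trans (hf₁ 9 (by simp)))
      ((hf₃' 11 (by simp)).trans (hf₁ 11 (by simp)))
      ((hf₃' 19 (by simp)).trans (hf₁' 19 (by simp) (by simp)))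
      ((hf₃' 14 (by simp)).trans hσ₁.1)) ?_) fun σ₄ f₄ hσ₄ => ?_)
  · rw [readBox_congr h15₁ (hf₃' _ (by simp)) (hf₃' _ (by simp)) (hf₃' _ (by simp))
      (hf₃' _ (by simp)), readBox_congr hσ₁.2 (hf₃' _ (by simp)) (hf₃' _ (by simp))
      (hf₃' _ (by simp)) (hf₃' _ (by simp))]
    rfl
  have hf₄ : ∀ r, r < 20 ∨ 28 ≤ r → σ₄.reg r = σ₃.reg r := fun r hr =>
    f₄.reg r (by simp [setBoxes, block, Prog.modReg]; omega)
  have hB₄ := hB₃.congr fun r hr => hf₄ r (by omega)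
  have e7 : σ₄.reg 7 = v := by rw [hf₄ 7 (by simp), hf₃ 7 (by simp), e7]
  have e8 : σ₄.reg 8 = ℓ := by rw [hf₄ 8 (by simp), hf₃ 8 (by simp), e8]
  refine Runs.block_cons (Runs.mono (runs_improve hs he h₁ h₂ hv hℓ
    (D := ⟨restBox P n i j, cornerBox P n i j, v, ℓ⟩)
    (by rw [readProblem, hσ₄.1, hσ₄.2, e7, e8]) rfl rfl
    (fun k hk => hPdef ▸ (cornerBox_or_restBox hk).symm) hB₄) fun σ₅ f₅ hB₅ => Runs.block_nil ?_)
  refine hB₅.mono fun R hR => ?_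
  rcases hR with rfl | hR
  · rcases min_choice (solve ⟨cornerBox P n i j, restBox P n i j, v, ℓ⟩).radius
      (solve ⟨restBox P n i j, cornerBox P n i j, v, ℓ⟩).radius with h | h
    · exact ⟨_, .inr (.inl rfl), by rw [candidateRadius, h]⟩
    · exact ⟨_, .inl rfl, by rw [candidateRadius, h]⟩
  · exact ⟨R, .inr (.inr hR), le_rfl⟩

theorem modReg_tryPair (e : Code) (s₁ s₂ : ℚ) {r : ℕ} (h7 : 7 ≤ r) (h20 : r < 20) (h : r ≠ 14) :
    r ∉ (tryPair e s₁ s₂).modReg := by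
  simp [tryPair, loadUpper, setBoxes, improve, block, Prog.modReg]
  omega

theorem modIdx_tryPair (e : Code) (s₁ s₂ : ℚ) : (tryPair e s₁ s₂).modIdx = [] := by
  simp [tryPair, loadUpper, setBoxes, improve, block, Prog.modIdx]

theorem modArr_tryPair (e : Code) (s₁ s₂ : ℚ) : (tryPair e s₁ s₂).modArr = [] := by
  simp [tryPair, loadUpper, setBoxes, improve, block, Prog.modArr]

theorem modReg_freshScan (c : Cond) {r : ℕ} (h : r < 13 ∨ 19 ≤ r) : r ∉ (freshScan c).modReg := by
  simp [freshScan, scan, forLoop, block, Prog.modReg]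
  omega

theorem modIdx_freshScan (c : Cond) : (freshScan c).modIdx = [2, 2] := by
  simp [freshScan, scan, forLoop, block, Prog.modIdx]

theorem modArr_freshScan (c : Cond) : (freshScan c).modArr = [] := by
  simp [freshScan, scan, forLoop, block, Prog.modArr]

/-- The radii of the candidates of the pairs of clients with abscissa from one of the first `k`
clients. -/
def candidateSet (solve : BoxProblem → BoxSolution) (v ℓ : ℝ) (P : ℕ → ℝ × ℝ) (n k : ℕ) : Set ℝ :=
  {R | ∃ i < k, ∃ j < n, R = candidateRadius solve v ℓ P n i j}

theorem runs_tryPairs (hs : IsSolver Feas solve) (he : e.Computes solve) (h₁ : IsSign s₁)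
    (h₂ : IsSign s₂) (hv : 1 < v) (hℓ : 0 ≤ ℓ) (hP : Holds n (oriented S s₁ s₂) σ)
    (hU : HoldsUpper n (oriented S s₁ s₂) n σ) (hE : readBox σ 9 = extent (oriented S s₁ s₂) n)
    (h7 : σ.reg 7 = v) (h8 : σ.reg 8 = ℓ) {B : Set ℝ} (hB : Best Feas v ℓ S B σ) :
    Runs n (tryPairs e s₁ s₂) σ
      (Best Feas v ℓ S (B ∪ candidateSet solve v ℓ (oriented S s₁ s₂) n n)) := by
  obtain ⟨P, hPdef⟩ : ∃ P, P = oriented S s₁ s₂ := ⟨_, rfl⟩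
  rw [← hPdef] at hP hU hE ⊢
  refine Runs.forLoop (fun k => Best Feas v ℓ S (B ∪ candidateSet solve v ℓ P n k))
    (fun k τ τ' h1 _ h => h.congr fun r _ => by rw [h1]) hP.size (by simp)
    (by simp [block, forLoop, Prog.modIdx, modIdx_freshScan, modIdx_tryPair])
    (by simp [block, forLoop, Prog.modIdx, modIdx_freshScan, modIdx_tryPair])
    (hB.mono fun R hR => ?_) fun i hi τ hτ hf hI => ?_
  · rcases hR with hR | ⟨i, hi, -⟩
    · exact ⟨R, hR, le_rfl⟩
    · omega
  have hfr : ∀ r, 7 ≤ r → r < 13 → τ.reg r = σ.reg r := fun r h h' => hf.reg r (by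
    have h1 := modReg_freshScan (.realLt (.reg 19) (.reg 13)) (r := r) (.inl h')
    have h2 := modReg_tryPair e s₁ s₂ (r := r) (by omega) (by omega) (by omega)
    simp [block, forLoop, Prog.modReg, h1, h2]
    omega)
  have hfa : τ.arr = σ.arr := funext fun a => hf.arr a (by
    simp [block, forLoop, Prog.modArr, modArr_freshScan, modArr_tryPair])
  have hPτ : Holds n P τ := hP.congr
    (hf.idx 0 (by simp [block, forLoop, Prog.modIdx, modIdx_freshScan, modIdx_tryPair]))
    (by rw [hfa]) (by rw [hfa])
  have hEτ : readBox τ 9 = extent P n := readBox_congr hE (hfr _ (by simp) (by simp))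
    (hfr _ (by simp) (by simp)) (hfr _ (by simp) (by simp)) (hfr _ (by simp) (by simp))
  refine Runs.block_cons (Runs.load (by simpa [IExpr.eval, hτ] using hi) ?_)
  refine Runs.block_cons (Runs.mono (runs_freshScan (P := P) (C := fun p => (P i).1 < p.1)
    (hPτ.congr rfl rfl rfl) (by simpa [readBox] using hEτ) fun ρ hρ => ?_) fun ρ hg hρ => ?_)
  · simp [Cond.Holds, RExpr.eval, hρ, IExpr.eval, hτ, hPτ.x i hi]
  have hρr : ∀ r, r < 13 → ρ.reg r = τ.reg r := fun r hr => by
    rw [hg.reg r (modReg_freshScan _ (.inl hr))]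
    have : r ≠ 19 := by omega
    simp [this]
  have hρ19 : ρ.reg 19 = (P i).1 := by
    rw [hg.reg 19 (modReg_freshScan _ (.inr le_rfl))]
    simp [IExpr.eval, hτ, hPτ.x i hi]
  have hρa : ρ.arr = σ.arr := funext fun a => by
    rw [hg.arr a (by simp [modArr_freshScan])]
    exact congrFun hfa a
  have hρP : Holds n P ρ := hPτ.congr (hg.idx 0 (by simp [modIdx_freshScan]))
    (by rw [hρa, hfa]) (by rw [hρa, hfa])
  -- the inner loop
  refine Runs.block_cons (Runs.mono (Runs.forLoop (fun k => Best Feas v ℓ S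
      ((B ∪ candidateSet solve v ℓ P n i) ∪ {R | ∃ j < k, R = candidateRadius solve v ℓ P n i j}))
    (fun k τ τ' h1 _ h => h.congr fun r _ => by rw [h1]) hρP.size (by simp)
    (by simp [modIdx_tryPair]) (by simp [modIdx_tryPair]) ?_ fun j hj κ hκ hh hJ => ?_)
    fun κ hh hκ => Runs.block_nil ?_)
  · refine (hI.congr fun r hr => hρr r (by omega)).mono fun R hR => ?_
    rcases hR with hR | ⟨j, hj, -⟩
    · exact ⟨R, hR, le_rfl⟩
    · omega
  · have hκr : ∀ r, 7 ≤ r → r < 20 → r ≠ 14 → κ.reg r = ρ.reg r := fun r h h' h'' =>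
      hh.reg r (by simpa [forLoop, Prog.modReg] using modReg_tryPair e s₁ s₂ h h' h'')
    have hκa : κ.arr = σ.arr := funext fun a => by
      rw [hh.arr a (by simp [forLoop, Prog.modArr, modArr_tryPair]), hρa]
    have hκσ : ∀ r, 7 ≤ r → r < 13 → κ.reg r = σ.reg r := fun r h h' => by
      rw [hκr r h (by omega) (by omega), hρr r h', hfr r h h']
    have hκP : Holds n P κ := hρP.congr
      (hh.idx 0 (by simp [forLoop, Prog.modIdx, modIdx_tryPair])) (by rw [hκa, hρa])
      (by rw [hκa, hρa])
    refine Runs.mono (runs_tryPair hs he h₁ h₂ hv hℓ (i := i) (j := j)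
      (hPdef ▸ hκP) ?_ ?_ ?_ ?_ ?_ ?_ hj hκ hJ) fun χ _ hχ => ?_
    · rw [← hPdef]
      unfold HoldsUpper
      rw [hκa]
      exact hU
    · rw [← hPdef]
      exact readBox_congr hE (hκσ _ (by simp) (by simp)) (hκσ _ (by simp) (by simp))
        (hκσ _ (by simp) (by simp)) (hκσ _ (by simp) (by simp))
    · rw [hκσ 7 (by simp) (by simp), h7]
    · rw [hκσ 8 (by simp) (by simp), h8]
    · rw [hκr 19 (by simp) (by simp) (by simp), hρ19, hPdef]
    · rw [← hPdef]
      exact readBox_congr hρ (hκr _ (by simp) (by simp) (by simp))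
        (hκr _ (by simp) (by simp) (by simp)) (hκr _ (by simp) (by simp) (by simp))
        (hκr _ (by simp) (by simp) (by simp))
    · refine hχ.mono fun R hR => ⟨R, ?_, le_rfl⟩
      rw [← hPdef]
      rcases hR with hR | ⟨j', hj', rfl⟩
      · exact .inr (.inl hR)
      · rcases Nat.lt_succ_iff_lt_or_eq.mp hj' with h | rfl
        · exact .inr (.inr ⟨j', h, rfl⟩)
        · exact .inl rfl
  · refine hκ.mono fun R hR => ⟨R, ?_, le_rfl⟩
    rcases hR with hR | ⟨i', hi', j, hj, rfl⟩
    · exact .inl (.inl hR)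
    · rcases Nat.lt_succ_iff_lt_or_eq.mp hi' with h | rfl
      · exact .inl (.inr ⟨i', h, j, hj, rfl⟩)
      · exact .inr ⟨j, hj, rfl⟩

theorem runs_phase (hs : IsSolver Feas solve) (he : e.Computes solve) (h₁ : IsSign s₁)
    (h₂ : IsSign s₂) (hv : 1 < v) (hℓ : 0 ≤ ℓ) (hσ : HasInput v ℓ S σ) {B : Set ℝ}
    (hB : Best Feas v ℓ S B σ) :
    Runs n (phase e s₁ s₂) σ fun τ => HasInput v ℓ S τ ∧
      Best Feas v ℓ S (B ∪ candidateSet solve v ℓ (oriented S s₁ s₂) n n) τ := by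
  have hframe : Runs n (phase e s₁ s₂) σ
      (Best Feas v ℓ S (B ∪ candidateSet solve v ℓ (oriented S s₁ s₂) n n)) := by
    refine Runs.block_cons (Runs.mono (runs_rotate (p := clients S) hσ.size hσ.x hσ.y)
      fun σ₁ f₁ hσ₁ => ?_)
    have hf₁ : ∀ r < 13, σ₁.reg r = σ.reg r := fun r hr =>
      f₁.reg r (by simp [rotate, forLoop, block, Prog.modReg]; omega)
    refine Runs.block_cons (Runs.mono (runs_findExtent (Nat.pos_of_ne_zero (NeZero.ne n)) hσ₁)
      fun σ₂ f₂ hσ₂ => ?_)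
    have hf₂ : ∀ r < 9, σ₂.reg r = σ₁.reg r := fun r hr =>
      f₂.reg r (by simp [findExtent, scan, forLoop, block, Prog.modReg]; omega)
    have hP₂ := hσ₁.congr
      (f₂.idx 0 (by simp [findExtent, scan, forLoop, block, Prog.modIdx]))
      (f₂.arr 2 (by simp [findExtent, scan, forLoop, block, Prog.modArr]))
      (f₂.arr 3 (by simp [findExtent, scan, forLoop, block, Prog.modArr]))
    refine Runs.block_cons (Runs.mono (runs_findUpper hP₂ hσ₂) fun σ₃ f₃ hσ₃ => ?_)
    have hf₃ : ∀ r < 13, σ₃.reg r = σ₂.reg r := fun r hr => f₃.reg r (by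
      have := modReg_freshScan (.realLt (.reg 19) (.reg 14)) (r := r) (.inl hr)
      simp [findUpper, forLoop, block, Prog.modReg, this]
      omega)
    have hP₃ := hP₂.congr
      (f₃.idx 0 (by simp [findUpper, forLoop, block, Prog.modIdx, modIdx_freshScan]))
      (f₃.arr 2 (by simp [findUpper, forLoop, block, Prog.modArr, modArr_freshScan]))
      (f₃.arr 3 (by simp [findUpper, forLoop, block, Prog.modArr, modArr_freshScan]))
    have hf : ∀ r < 9, σ₃.reg r = σ.reg r := fun r hr => by
      rw [hf₃ r (by omega), hf₂ r hr, hf₁ r (by omega)]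
    refine Runs.block_cons (Runs.mono (runs_tryPairs hs he h₁ h₂ hv hℓ hP₃ hσ₃
      (readBox_congr hσ₂ (hf₃ _ (by simp)) (hf₃ _ (by simp)) (hf₃ _ (by simp)) (hf₃ _ (by simp)))
      ((hf 7 (by simp)).trans hσ.v) ((hf 8 (by simp)).trans hσ.ℓ)
      (hB.congr fun r hr => hf r (by omega))) fun σ₄ _ hσ₄ => Runs.block_nil hσ₄)
  refine hframe.mono fun τ hf hτ => ⟨hσ.congr ?_ ?_ ?_ ?_ ?_, hτ⟩
  · exact hf.idx 0 (by simp [phase, rotate, findExtent, findUpper, tryPairs, scan, forLoop, block,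
      Prog.modIdx, modIdx_freshScan, modIdx_tryPair])
  · exact hf.arr 0 (by simp [phase, rotate, findExtent, findUpper, tryPairs, scan, forLoop, block,
      Prog.modArr, modArr_freshScan, modArr_tryPair])
  · exact hf.arr 1 (by simp [phase, rotate, findExtent, findUpper, tryPairs, scan, forLoop, block,
      Prog.modArr, modArr_freshScan, modArr_tryPair])
  · exact hf.reg 7 (by simp [phase, rotate, findExtent, findUpper, tryPairs, scan, forLoop, block,
      Prog.modReg, modReg_freshScan, modReg_tryPair])
  · exact hf.reg 8 (by simp [phase, rotate, findExtent, findUpper, tryPairs, scan, forLoop, block,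
      Prog.modReg, modReg_freshScan, modReg_tryPair])

theorem runs_startWalking (hfeas : Feas ℓ ℓ) (hℓ : 0 ≤ ℓ) (h8 : σ.reg 8 = ℓ)
    (hE : readBox σ 9 = extent (oriented S 1 1) n) :
    Runs n startWalking σ (Best Feas v ℓ S {(extent (oriented S 1 1) n).halfSide}) := by
  have h := walkingPlacement_achieves (v := v) (S := S) hfeas hℓ
  rw [← hE] at h ⊢
  refine Runs.block_cons (Runs.setReg (Runs.block_cons (Runs.setReg ?_)))
  refine Runs.block_cons (Runs.setReg (Runs.block_cons (Runs.setReg ?_)))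
  refine Runs.block_cons (Runs.setReg (Runs.block_cons (Runs.setReg ?_)))
  refine Runs.block_cons (Runs.setReg (Runs.block_cons (Runs.setReg ?_)))
  refine Runs.block_cons (Runs.setReg (Runs.block_cons (Runs.setReg ?_)))
  refine Runs.block_cons (Runs.setReg (Runs.block_nil ⟨?_, ?_⟩))
  · simpa [output, RExpr.eval, unorientX, unorientY, walkingPlacement, unorient, readBox,
      Box.halfSide, h8] using h
  · simp [RExpr.eval, readBox, Box.halfSide]

theorem runs_program (hs : IsSolver Feas solve) (he : e.Computes solve) (hfeas : Feas ℓ ℓ)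
    (hv : 1 < v) (hℓ : 0 ≤ ℓ) :
    Runs n (program e) (input v ℓ S) fun τ => Feas ℓ (output τ).length ∧
      ∀ Q : Placement, Feas ℓ Q.length → (output τ).radius v S ≤ Q.radius v S := by
  have hone : IsSign 1 := .inl rfl
  have hneg : IsSign (-1) := .inr rfl
  refine Runs.block_cons (Runs.mono runs_moveParameters fun σ₀ _ h0 => ?_)
  refine Runs.block_cons (Runs.mono (runs_rotate (p := clients S) h0.size h0.x h0.y)
    fun σ₁ f₁ hσ₁ => ?_)
  have h1 := h0.congr (f₁.idx 0 (by simp [rotate, forLoop, block, Prog.modIdx]))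
    (f₁.arr 0 (by simp [rotate, forLoop, block, Prog.modArr]))
    (f₁.arr 1 (by simp [rotate, forLoop, block, Prog.modArr]))
    (f₁.reg 7 (by simp [rotate, forLoop, block, Prog.modReg]))
    (f₁.reg 8 (by simp [rotate, forLoop, block, Prog.modReg]))
  refine Runs.block_cons (Runs.mono (runs_findExtent (Nat.pos_of_ne_zero (NeZero.ne n)) hσ₁)
    fun σ₂ f₂ hσ₂ => ?_)
  have h2 := h1.congr (f₂.idx 0 (by simp [findExtent, scan, forLoop, block, Prog.modIdx]))
    (f₂.arr 0 (by simp [findExtent, scan, forLoop, block, Prog.modArr]))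
    (f₂.arr 1 (by simp [findExtent, scan, forLoop, block, Prog.modArr]))
    (f₂.reg 7 (by simp [findExtent, scan, forLoop, block, Prog.modReg]))
    (f₂.reg 8 (by simp [findExtent, scan, forLoop, block, Prog.modReg]))
  refine Runs.block_cons (Runs.mono (runs_startWalking (v := v) hfeas hℓ h2.ℓ hσ₂)
    fun σ₃ f₃ hσ₃ => ?_)
  have h3 := h2.congr (f₃.idx 0 (by simp [startWalking, block, Prog.modIdx]))
    (f₃.arr 0 (by simp [startWalking, block, Prog.modArr]))
    (f₃.arr 1 (by simp [startWalking, block, Prog.modArr]))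
    (f₃.reg 7 (by simp [startWalking, block, Prog.modReg]))
    (f₃.reg 8 (by simp [startWalking, block, Prog.modReg]))
  refine Runs.block_cons (Runs.mono (runs_phase hs he hone hone hv hℓ h3 hσ₃)
    fun σ₄ _ h4 => ?_)
  refine Runs.block_cons (Runs.mono (runs_phase hs he hone hneg hv hℓ h4.1 h4.2)
    fun σ₅ _ h5 => ?_)
  refine Runs.block_cons (Runs.mono (runs_phase hs he hneg hone hv hℓ h5.1 h5.2)
    fun σ₆ _ h6 => ?_)
  refine Runs.block_cons (Runs.mono (runs_phase hs he hneg hneg hv hℓ h6.1 h6.2)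
    fun σ₇ _ h7 => Runs.block_nil ?_)
  obtain ⟨-, ⟨hF, hrad⟩, hbest⟩ := h7
  refine ⟨hF, fun Q hQ => hrad.trans ?_⟩
  rcases exists_candidateRadius_le (S := S) hs hv hℓ Q hQ with h | ⟨s₁, s₂, hs₁, hs₂, i, hi, j, hj, h⟩
  · exact (hbest _ (.inl (.inl (.inl (.inl rfl))))).trans h
  · refine (hbest _ ?_).trans h
    rcases hs₁ with rfl | rfl <;> rcases hs₂ with rfl | rfl
    · exact .inl (.inl (.inl (.inr ⟨i, hi, j, hj, rfl⟩)))
    · exact .inl (.inl (.inr ⟨i, hi, j, hj, rfl⟩))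
    · exact .inl (.inr ⟨i, hi, j, hj, rfl⟩)
    · exact .inr ⟨i, hi, j, hj, rfl⟩

end Candidates

end Turnpike

theorem mainTheorem1 :
    (∃ (A : RealRAM.Prog) (T M : ℕ → ℕ), Turnpike.SolvesFL A T M ∧
      (fun n => (T n : ℝ)) =O[atTop] (fun n => (n : ℝ) ^ 2) ∧
      (fun n => (M n : ℝ)) =O[atTop] (fun n => (n : ℝ))) ∧
    (∃ (A : RealRAM.Prog) (T M : ℕ → ℕ), Turnpike.SolvesVL A T M ∧
      (fun n => (T n : ℝ)) =O[atTop] (fun n => (n : ℝ) ^ 2) ∧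
      (fun n => (M n : ℝ)) =O[atTop] (fun n => (n : ℝ))) := by
  constructor
  · obtain ⟨e, he⟩ := Turnpike.isSolver_solveFL.exists_code
    refine ⟨Turnpike.program e, (Turnpike.program e).timeBound, id, ?_,
      RealRAM.Prog.timeBound_isBigO _ (Turnpike.depth_program e), isBigO_refl _ _⟩
    intro n _ S v ℓ hv hℓ
    obtain ⟨k, τ, hk, hle, h⟩ :=
      Turnpike.runs_program (S := S) Turnpike.isSolver_solveFL he rfl hv hℓ
    exact ⟨k, τ, hk, hle, h⟩
  · obtain ⟨e, he⟩ := Turnpike.isSolver_solveVL.exists_code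
    refine ⟨Turnpike.program e, (Turnpike.program e).timeBound, id, ?_,
      RealRAM.Prog.timeBound_isBigO _ (Turnpike.depth_program e), isBigO_refl _ _⟩
    intro n _ S v hv
    obtain ⟨k, τ, hk, hle, h⟩ :=
      Turnpike.runs_program (S := S) Turnpike.isSolver_solveVL he trivial hv le_rfl
    exact ⟨k, τ, hk, hle, fun Q => h.2 Q trivial⟩
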